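/- **Setting.** Let $\mathcal S\subseteq\mathbb R^{n_s}$, $\mathcal Z\subseteq\mathbb R^{n_z}$, $\mathcal A\subseteq\mathbb R^{n_a}$ be compact, and let $\dot{\mathcal S}=\mathcal S\times\mathcal Z$ be the augmented state space, with transition law $P_{\mathrm T}(\mathrm ds',\mathrm dz'\mid (s,z),a)=P_{\mathrm T}^{z}(\mathrm ds'\mid s,a)\,P_{\mathrm{shift}}(\mathrm dz'\mid z)$ and some initial law. For $k=0,\dots,K$ let $C'_k(s,a)$ be measurable costs and $V_k(\dot s)$ measurable potentials such that the reshaped costs $\dot C'_k(\dot s,a,\dot s')=C'_k(s,a)+V_k(\dot s')-V_k(\dot s)$ are bounded. Policies $\pi_\theta(a\mid\dot s)$, $\theta\in\Theta\subseteq\mathbb R^{n_\theta}$, are given by densities with respect to a finite reference measure on $\mathcal A$. Put $$\dot f_k(\theta)=\lim_{T\to\infty}\frac1T\,\mathbb E_{\pi_\theta}\Bigl[\sum_{t=0}^{T-1}\dot C'_k(\dot s_t,a_t,\dot s_{t+1})\Bigr],\qquad Q_k^{\pi_\theta}(\dot s,a)=\mathbb E_{\pi_\theta}\Bigl[\sum_{l=0}^{\infty}\bigl(\dot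 C'_{k,l}-\dot f_k(\theta)\bigr)\Bigm|\dot s_0=\dot s,a_0=a\Bigr],$$ and, for $c\in\mathbb R$, $T\in\mathbb N$, $\hat Q_k^{\pi_\theta,c,T}(\dot s,a)=\mathbb E_{\pi_\theta}\bigl[\sum_{l=0}^{T-1}(\dot C'_{k,l}-c)\mid\dot s_0=\dot s,a_0=a\bigr]$. **Assumption 1.** $\Theta$ is compact and convex with nonempty interior. The densities are positive, normalized, jointly continuous in $(\theta,\dot s,a)$ and differentiable in $\theta\in\Theta$ with a gradient that is jointly continuous, and they are Lipschitz in $\theta\in\Theta$ uniformly in $(\dot s,a)$. Each $\dot f_k$ is differentiable on $\Theta$ with bounded and Lipschitz gradient. There are $\lambda>0$ and $\rho\in(0,1)$ such that for every $\theta\in\Theta$ the chain of augmented states under $\pi_\theta$ has a stationary law $\mathbf P_{\pi_\theta}$ with $\sup_{\dot s}d_{\mathrm{TV}}\bigl(P(\dot s_t\in\cdot\mid\dot s_0=\dot s),\mathbf P_{\pi_\theta}\bigr)\le\lambda\rho^t$ for all $t\ge0$, where $d_{\mathrm{TV}}(\alpha,\beta)=\int|\alpha(\mathrm d\dot s)-\beta(\mathrm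 d\dot s)|$. **Assumption 2.** $(\mu_i)$ and $(\eta_i)$ are deterministic, positive and non-increasing, $\mu_i\le1$, $\mu_i\to0$, $\sum_i\mu_i=\infty$, $\sum_i\mu_i^2<\infty$, $\eta_i\to0$, $1/\eta_i=O(i^{\varrho})$ for some $\varrho\in(0,1)$, $\sum_i\eta_i^2<\infty$, and $\mu_i/\eta_i\to0$. **Algorithm.** Let $B\ge1$ and $\zeta_k>0$. A trajectory $\dot s_0,a_0,\dot s_1,a_1,\dots$ is generated in which the actions at times $t\in\varepsilon_i=\{iB,\dots,iB+B-1\}$ are drawn from $\pi_{\theta_i}$, where $\theta_i$ is determined by the information available before time $iB$, and $\theta_0\in\Theta$. With arbitrary initial values $\hat f_{k,0}$ (known at time $0$) and $\hat g_{k,0}$, $$\hat f_{k,i+1}=(1-\eta_{i+1})\hat f_{k,i}+\eta_i\,\frac1B\sum_{t\in\varepsilon_i}\dot C'_k(\dot s_t,a_t,\dot s_{t+1}),$$ $$\hat g_{k,i+1}=(1-\eta_{i+1})\hat g_{k,i}+\eta_i\,\frac1B\sum_{t\in\varepsilon_i}Q_{\omega_{k,i}}(\dot s_t,a_t)\,\nabla_\theta\log\pi_{\theta_i}(a_t\mid\dot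 s_t),$$ where $Q_{\omega_{k,i}}$ are Q-networks whose parameters may be updated in any way. With $\bar f_{k,i}(\theta)=\hat f_{k,i}+\hat g_{k,i}^{\mathsf T}(\theta-\theta_i)+\zeta_k\|\theta-\theta_i\|_2^2$, let $\bar\theta_i$ solve $\min_{\theta\in\Theta}\bar f_{0,i}(\theta)$ s.t. $\bar f_{k,i}(\theta)\le0$ for $k=1,\dots,K$ if this is feasible, and otherwise $\min_{\theta\in\Theta,\alpha}\alpha$ s.t. $\bar f_{k,i}(\theta)\le\alpha$ for $k=1,\dots,K$; then $\theta_{i+1}=(1-\mu_{i+1})\theta_i+\mu_{i+1}\bar\theta_i$. **Lemma 2 (asymptotic consistency of surrogate functions).** Under Assumptions 1 and 2 the limits defining $\dot f_k(\theta)$ exist and the series defining $Q_k^{\pi_\theta}$ (of the conditional expectations) converge for all $\theta\in\Theta$, and, for every $k=0,\dots,K$: 1. $\lim_{i\to\infty}\bigl|\hat f_{k,i}-\dot f_k(\theta_i)\bigr|=0$ almost surely. 2. $\limsup_{i\to\infty}\bigl\|\hat g_{k,i}-\nabla\dot f_k(\theta_i)\bigr\|_2\le\epsilon_Q$ almost surely,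 where $\epsilon_Q=C\,\limsup_{i\to\infty}\sup_{\dot s,a}\bigl|Q_{\omega_{k,i}}(\dot s,a)-\hat Q_{k,i}(\dot s,a)\bigr|$. Here $C>0$ depends only on the decision process and the policy family (not on the step sizes, $B$, the Q-networks or the run), and $\hat Q_{k,i}$ is either of the following: (a) the surrogate value function $\hat Q_{k,i}=\hat Q_k^{\pi_{\theta_i},\hat f_{k,i},T_i}$ for any deterministic horizons $T_i\to\infty$, the bound holding almost surely on the event that these functions are bounded uniformly in $i,\dot s,a$; (b) the exact value function $\hat Q_{k,i}=Q_k^{\pi_{\theta_i}}$. -/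

import Mathlib

open MeasureTheory ProbabilityTheory Filter Topology Set
open scoped ENNReal NNReal

noncomputable section

namespace CACRL

/-- The parameter-dependent constrained Markov decision process: state space `S`, latent space `Z`,
action space `A`, the transition law `P_T^z(· ∣ s, a)` of the state, the law
`P_shift(· ∣ z)` of the latent variable, the law of the initial augmented state, the instantaneous
objective/constraint costs `C'_k(s, a)`, `k = 0, …, K`, and the potentials `V_k` used for
reward-reshaping. -/
structure CMDP (nS nZ nA K : ℕ) where
  S : Set (EuclideanSpace ℝ (Fin nS))
  Z : Set (EuclideanSpace ℝ (Fin nZ))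
  A : Set (EuclideanSpace ℝ (Fin nA))
  trans : Kernel ((S × Z) × A) S
  shift : Kernel Z Z
  init : Measure (S × Z)
  cost : Fin (K + 1) → S → A → ℝ
  pot : Fin (K + 1) → S × Z → ℝ
  isMarkov_trans : IsMarkovKernel trans
  isMarkov_shift : IsMarkovKernel shift
  isProb_init : IsProbabilityMeasure init
  measurable_cost : ∀ k, Measurable (Function.uncurry (cost k))
  measurable_pot : ∀ k, Measurable (pot k)

namespace CMDP

variable {nS nZ nA K : ℕ}

/-- The augmented state space `S × Z`. -/
abbrev X (M : CMDP nS nZ nA K) : Type := M.S × M.Z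

/-- The transition kernel of the augmented CMDP,
`P_T(ds', dz' ∣ (s, z), a) = P_T^z(ds' ∣ s, a) P_shift(dz' ∣ z)`. -/
def augTrans (M : CMDP nS nZ nA K) : Kernel (M.X × M.A) M.X :=
  M.trans ×ₖ M.shift.comap (fun q : M.X × M.A => q.1.2) (measurable_snd.comp measurable_fst)

/-- The reshaped cost `C'_k(s, a) + V_k(s', z') - V_k(s, z)`. -/
def shapedCost (M : CMDP nS nZ nA K) (k : Fin (K + 1)) (x : M.X) (a : M.A) (x' : M.X) : ℝ :=
  M.cost k x.1 a + (M.pot k x' - M.pot k x)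

end CMDP

/-- A parametrized family of stochastic policies, given by densities
`dens θ x a = π_θ(a ∣ x)` with respect to a finite reference measure on the action space
(for instance Lebesgue measure on `A`). -/
structure Policy {nS nZ nA K : ℕ} (M : CMDP nS nZ nA K) (nθ : ℕ) where
  ref : Measure M.A
  isFinite_ref : IsFiniteMeasure ref
  dens : EuclideanSpace ℝ (Fin nθ) → M.X → M.A → ℝ

namespace Policy

variable {nS nZ nA K nθ : ℕ} {M : CMDP nS nZ nA K}

attribute [instance] Policy.isFinite_ref

/-- The policy as a kernel, `π_θ(da ∣ x)`. -/
def kernel (π : Policy M nθ) (θ : EuclideanSpace ℝ (Fin nθ)) : Kernel M.X M.A :=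
  (Kernel.const M.X π.ref).withDensity (fun x a => ENNReal.ofReal (π.dens θ x a))

/-- The joint law of `(a_t, x_{t+1})` given `x_t` when actions are drawn from `π_θ`. -/
def step (π : Policy M nθ) (θ : EuclideanSpace ℝ (Fin nθ)) : Kernel M.X (M.A × M.X) :=
  π.kernel θ ⊗ₖ M.augTrans

/-- The transition kernel of the Markov chain of augmented states under `π_θ`. -/
def chain (π : Policy M nθ) (θ : EuclideanSpace ℝ (Fin nθ)) : Kernel M.X M.X :=
  (π.step θ).snd

/-- The law of `x_t` given `x_0` under the fixed policy `π_θ`. -/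
def nStep (π : Policy M nθ) (θ : EuclideanSpace ℝ (Fin nθ)) : ℕ → Kernel M.X M.X
  | 0 => Kernel.id
  | t + 1 => π.chain θ ∘ₖ π.nStep θ t

/-- `𝔼[Ċ'_k(x_t, a_t, x_{t+1}) ∣ x_t = x]` under `π_θ`. -/
def meanCost (π : Policy M nθ) (k : Fin (K + 1)) (θ : EuclideanSpace ℝ (Fin nθ)) (x : M.X) : ℝ :=
  ∫ p, M.shapedCost k x p.1 p.2 ∂(π.step θ x)

/-- `T⁻¹ 𝔼[∑_{t < T} Ċ'_k(x_t, a_t, x_{t+1})]` under `π_θ`, with `x_0 ∼ M.init`. -/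
def avgCost (π : Policy M nθ) (k : Fin (K + 1)) (θ : EuclideanSpace ℝ (Fin nθ)) (T : ℕ) : ℝ :=
  (T : ℝ)⁻¹ * ∑ t ∈ Finset.range T, ∫ x₀, ∫ x, π.meanCost k θ x ∂(π.nStep θ t x₀) ∂M.init

/-- The reshaped objective/constraint function `ḟ_k(θ)`: the long-run average reshaped cost. -/
def fdot (π : Policy M nθ) (k : Fin (K + 1)) (θ : EuclideanSpace ℝ (Fin nθ)) : ℝ :=
  limUnder atTop (π.avgCost k θ)

/-- `𝔼[Ċ'_{k,l} ∣ x_0 = x, a_0 = a]` under `π_θ`. -/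
def costAt (π : Policy M nθ) (k : Fin (K + 1)) (θ : EuclideanSpace ℝ (Fin nθ)) (x : M.X) (a : M.A) :
    ℕ → ℝ
  | 0 => ∫ x', M.shapedCost k x a x' ∂(M.augTrans (x, a))
  | l + 1 => ∫ x', ∫ y, π.meanCost k θ y ∂(π.nStep θ l x') ∂(M.augTrans (x, a))

/-- The state-action value function
`Q_k^{π_θ}(x, a) = 𝔼[∑_{l ≥ 0} (Ċ'_{k,l} - ḟ_k(θ)) ∣ x_0 = x, a_0 = a]`. -/
def Q (π : Policy M nθ) (k : Fin (K + 1)) (θ : EuclideanSpace ℝ (Fin nθ)) (x : M.X) (a : M.A) : ℝ :=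
  ∑' l, (π.costAt k θ x a l - π.fdot k θ)

/-- The surrogate value function with the estimate `c` in place of `ḟ_k(θ)`, up to horizon `T`:
`𝔼[∑_{l < T} (Ċ'_{k,l} - c) ∣ x_0 = x, a_0 = a]`. -/
def Qhat (π : Policy M nθ) (k : Fin (K + 1)) (θ : EuclideanSpace ℝ (Fin nθ)) (c : ℝ) (T : ℕ)
    (x : M.X) (a : M.A) : ℝ :=
  ∑ l ∈ Finset.range T, (π.costAt k θ x a l - c)

/-- The score `∇_θ log π_θ(a ∣ x)`, `θ ∈ Θ`. -/
def score (π : Policy M nθ) (Θ : Set (EuclideanSpace ℝ (Fin nθ))) (θ : EuclideanSpace ℝ (Fin nθ))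
    (x : M.X) (a : M.A) : EuclideanSpace ℝ (Fin nθ) :=
  gradientWithin (fun θ' => Real.log (π.dens θ' x a)) Θ θ

/-- The gradient `∇ḟ_k(θ)`, `θ ∈ Θ`. -/
def gradF (π : Policy M nθ) (Θ : Set (EuclideanSpace ℝ (Fin nθ))) (k : Fin (K + 1))
    (θ : EuclideanSpace ℝ (Fin nθ)) : EuclideanSpace ℝ (Fin nθ) :=
  gradientWithin (π.fdot k) Θ θ

/-- The family is a smooth family of probability densities over `Θ`, like a Gaussian policy on a
compact action space whose mean and variance are smooth networks: the densities are positive and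
normalized, and they are continuously differentiable in `θ`, jointly continuously in all
arguments. -/
structure IsSmooth (π : Policy M nθ) (Θ : Set (EuclideanSpace ℝ (Fin nθ))) : Prop where
  pos : ∀ θ ∈ Θ, ∀ x a, 0 < π.dens θ x a
  normalized : ∀ θ ∈ Θ, ∀ x, ∫ a, π.dens θ x a ∂π.ref = 1
  continuousOn : ContinuousOn
    (fun q : EuclideanSpace ℝ (Fin nθ) × M.X × M.A => π.dens q.1 q.2.1 q.2.2) (Θ ×ˢ univ)
  differentiableOn : ∀ x a, DifferentiableOn ℝ (fun θ => π.dens θ x a) Θ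
  continuousOn_gradient : ContinuousOn
    (fun q : EuclideanSpace ℝ (Fin nθ) × M.X × M.A =>
      gradientWithin (fun θ => π.dens θ q.2.1 q.2.2) Θ q.1) (Θ ×ˢ univ)

end Policy

/-- Total variation `∫ |α(dx) - β(dx)|`, computed with densities with respect to `α + β`. -/
def tvDist {X : Type*} [MeasurableSpace X] (α β : Measure X) : ℝ≥0∞ :=
  ∫⁻ x, ‖(α.rnDeriv (α + β) x).toReal - (β.rnDeriv (α + β) x).toReal‖ₑ ∂(α + β)

/-- The assumptions on the problem structure. -/
structure ProblemAssumptions {nS nZ nA K nθ : ℕ} (M : CMDP nS nZ nA K) (π : Policy M nθ)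
    (Θ : Set (EuclideanSpace ℝ (Fin nθ))) : Prop where
  isCompact_S : IsCompact M.S
  isCompact_Z : IsCompact M.Z
  isCompact_A : IsCompact M.A
  cost_bounded : ∃ c : ℝ, ∀ k x a x', |M.shapedCost k x a x'| ≤ c
  isCompact_Θ : IsCompact Θ
  convex_Θ : Convex ℝ Θ
  interior_Θ : (interior Θ).Nonempty
  policy_smooth : π.IsSmooth Θ
  policy_lipschitz : ∃ L : ℝ≥0, ∀ x a, LipschitzOnWith L (fun θ => π.dens θ x a) Θ
  differentiable : ∀ k, DifferentiableOn ℝ (π.fdot k) Θ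
  gradient_bounded : ∃ c : ℝ, ∀ k, ∀ θ ∈ Θ, ‖π.gradF Θ k θ‖ ≤ c
  gradient_lipschitz : ∃ L : ℝ≥0, ∀ k, LipschitzOnWith L (π.gradF Θ k) Θ
  ergodic : ∃ lam : ℝ, 0 < lam ∧ ∃ ρ : ℝ, 0 < ρ ∧ ρ < 1 ∧ ∀ θ ∈ Θ,
    ∃ d : Measure M.X, IsProbabilityMeasure d ∧ (π.chain θ).Invariant d ∧
      ∀ (x : M.X) (t : ℕ), tvDist (π.nStep θ t x) d ≤ ENNReal.ofReal (lam * ρ ^ t)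

/-- The assumptions on the step sizes `η_i` (averaging of the estimates) and `μ_i` (update of
`θ`). -/
structure StepSizeAssumptions (η μ : ℕ → ℝ) : Prop where
  antitone_μ : Antitone μ
  pos_μ : ∀ i, 0 < μ i
  le_one_μ : ∀ i, μ i ≤ 1
  tendsto_μ : Tendsto μ atTop (𝓝 0)
  sum_μ : ¬ Summable μ
  sum_sq_μ : Summable (fun i => μ i ^ 2)
  antitone_η : Antitone η
  pos_η : ∀ i, 0 < η i
  tendsto_η : Tendsto η atTop (𝓝 0)
  inv_η : ∃ ϱ : ℝ, 0 < ϱ ∧ ϱ < 1 ∧ (fun i => 1 / η i) =O[atTop] (fun i : ℕ => (i : ℝ) ^ ϱ)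
  sum_sq_η : Summable (fun i => η i ^ 2)
  tendsto_ratio : Tendsto (fun i => μ i * (η i)⁻¹) atTop (𝓝 0)

/-- The convex quadratic surrogate `f + gᵀ(θ - θ₀) + ζ ‖θ - θ₀‖²`. -/
def surrogate {n : ℕ} (f : ℝ) (g : EuclideanSpace ℝ (Fin n)) (ζ : ℝ)
    (θ₀ θ : EuclideanSpace ℝ (Fin n)) : ℝ :=
  f + inner ℝ g (θ - θ₀) + ζ * ‖θ - θ₀‖ ^ 2

/-- `θb` solves the objective update `min_{θ ∈ Θ} F_0(θ)` s.t. `F_k(θ) ≤ 0`, `k = 1, …, K`, if this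
problem is feasible, and otherwise the feasible update `min_{θ ∈ Θ, α} α` s.t. `F_k(θ) ≤ α`,
`k = 1, …, K`. -/
def IsActorSolution {n K : ℕ} (Θ : Set (EuclideanSpace ℝ (Fin n)))
    (F : Fin (K + 1) → EuclideanSpace ℝ (Fin n) → ℝ) (θb : EuclideanSpace ℝ (Fin n)) : Prop :=
  ((∃ θ ∈ Θ, ∀ k : Fin K, F k.succ θ ≤ 0) →
    θb ∈ Θ ∧ (∀ k : Fin K, F k.succ θb ≤ 0) ∧
      ∀ θ ∈ Θ, (∀ k : Fin K, F k.succ θ ≤ 0) → F 0 θb ≤ F 0 θ) ∧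
  ((¬ ∃ θ ∈ Θ, ∀ k : Fin K, F k.succ θ ≤ 0) →
    θb ∈ Θ ∧ ∃ α : ℝ, (∀ k : Fin K, F k.succ θb ≤ α) ∧
      ∀ θ ∈ Θ, ∀ α' : ℝ, (∀ k : Fin K, F k.succ θ ≤ α') → α ≤ α')

/-- A run of the algorithm on a probability space: one trajectory `x_0, a_0, x_1, a_1, …` of the
augmented CMDP, in which the actions at times `iB, …, iB + B - 1` (the `i`-th observation set) are
drawn from `π_{θ_i}`, together with the iterates and estimates computed from it. The parameters
`w i ω k` of the Q-networks may be updated in an arbitrary way. -/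
structure Run {nS nZ nA K nθ nω : ℕ} (M : CMDP nS nZ nA K) (π : Policy M nθ)
    (Θ : Set (EuclideanSpace ℝ (Fin nθ))) (B : ℕ) (η μ : ℕ → ℝ) (ζ : Fin (K + 1) → ℝ)
    (Qnet : Fin (K + 1) → EuclideanSpace ℝ (Fin nω) → M.X → M.A → ℝ)
    {Ω : Type*} [mΩ : MeasurableSpace Ω] (P : Measure Ω) where
  /-- `ℱ t` is the information available when the action at time `t` is drawn. -/
  ℱ : Filtration ℕ mΩ
  x : ℕ → Ω → M.X
  a : ℕ → Ω → M.A
  θ : ℕ → Ω → EuclideanSpace ℝ (Fin nθ)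
  θbar : ℕ → Ω → EuclideanSpace ℝ (Fin nθ)
  fhat : ℕ → Ω → Fin (K + 1) → ℝ
  ghat : ℕ → Ω → Fin (K + 1) → EuclideanSpace ℝ (Fin nθ)
  w : ℕ → Ω → Fin (K + 1) → EuclideanSpace ℝ (Fin nω)
  measurable_x : ∀ t, Measurable[ℱ t] (x t)
  measurable_a : ∀ t, Measurable[ℱ (t + 1)] (a t)
  measurable_θ : ∀ i, Measurable[ℱ (i * B)] (θ i)
  measurable_fhat_zero : Measurable[ℱ 0] (fhat 0)
  law_init : P.map (x 0) = M.init
  law_step : ∀ (t : ℕ) (U : Set (M.A × M.X)), MeasurableSet U →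
    P[((fun ω => (a t ω, x (t + 1) ω)) ⁻¹' U).indicator (fun _ => (1 : ℝ)) | ℱ t]
      =ᵐ[P] fun ω => (π.step (θ (t / B) ω) (x t ω)).real U
  /-- Averaging of the sample means of the reshaped costs. -/
  fhat_succ : ∀ i ω k, fhat (i + 1) ω k = (1 - η (i + 1)) * fhat i ω k +
    η i * ((B : ℝ)⁻¹ * ∑ j ∈ Finset.range B,
      M.shapedCost k (x (i * B + j) ω) (a (i * B + j) ω) (x (i * B + j + 1) ω))
  /-- Averaging of the sample policy gradients computed with the Q-networks. -/
  ghat_succ : ∀ i ω k, ghat (i + 1) ω k = (1 - η (i + 1)) • ghat i ω k +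
    η i • ((B : ℝ)⁻¹ • ∑ j ∈ Finset.range B,
      Qnet k (w i ω k) (x (i * B + j) ω) (a (i * B + j) ω) •
        π.score Θ (θ i ω) (x (i * B + j) ω) (a (i * B + j) ω))
  θ_zero : ∀ ω, θ 0 ω ∈ Θ
  θbar_spec : ∀ i ω, IsActorSolution Θ
    (fun k => surrogate (fhat i ω k) (ghat i ω k) (ζ k) (θ i ω)) (θbar i ω)
  θ_succ : ∀ i ω, θ (i + 1) ω = (1 - μ (i + 1)) • θ i ω + μ (i + 1) • θbar i ω

end CACRL

end

/-! Each estimate is an exponential average, at rate η, of samples from a Markov chain whose policy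
parameter drifts at rate μ = o(η). Since `fdot` and its gradient are Lipschitz on Θ, the target
moves by O(μ) per update, which is negligible against η. `limsup_tracking` therefore reduces
everything to one claim: the η-weighted deviations of the batch means from the target, corrected by
a bias sequence r, form a convergent series. The limsup of the estimation error is then at most that
of ‖r‖.

The claim rests on the Poisson equation. Uniform geometric ergodicity makes v_θ = Σ_t (P_θ^t F_θ -
stationary mean) converge, and F_θ - mean = v_θ - P_θ v_θ. Along the run, a sample's deviation from
the mean is thus a bounded martingale difference plus an increment of v_θ. The martingale part
converges because Σ η² < ∞. The increments telescope inside a batch and are summed by parts across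
batches. Changing the parameter between batches costs v_{θ_{i+1}} - v_{θ_i}, a vanishing bias
because v is uniformly continuous in θ, uniformly in the state. No continuity of the transition law
in the state is needed, since θ enters the chain only through the Lipschitz densities. This is
`ae_exists_tendsto_batch`; with the reshaped cost as sample it gives the consistency of the function
values.

For the gradients, the policy gradient theorem `gradF_eq`, deduced from the performance difference
formula `fdot_sub_eq`, identifies the target as the stationary mean of Q times the score. Replacing
Q by a network adds a bias of at most its sup error times the sup of the score, and this sup is
essentially the constant C. A surrogate value function differs from Q by a vanishing truncation
error and by T_i (fdot - fhat_i), which depends on neither state nor action and is known when the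
batch starts. Scores have conditional mean zero, so such a baseline contributes only a convergent
martingale as soon as it is bounded. This is why boundedness of the surrogates suffices and no rate
for fhat is required. -/

namespace CACRL

/-! ### Deterministic recursions -/

/-- Since 1 - η ≤ exp(-η), the iterates are dominated by c 0 times the exponential of minus the
partial sums of η, which diverge. -/
theorem tendsto_zero_of_le_one_sub_mul {η c : ℕ → ℝ} (hη : ∀ n, 0 ≤ η n) (hη1 : ∀ n, η n ≤ 1)
    (hs : ¬ Summable η) (hc : ∀ n, 0 ≤ c n) (h : ∀ n, c (n + 1) ≤ (1 - η n) * c n) :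
    Tendsto c atTop (𝓝 0) := by
  have key : ∀ n, c n ≤ c 0 * Real.exp (-∑ i ∈ Finset.range n, η i) := by
    intro n
    induction n with
    | zero => simp
    | succ n ih =>
      calc c (n + 1) ≤ (1 - η n) * c n := h n
        _ ≤ (1 - η n) * (c 0 * Real.exp (-∑ i ∈ Finset.range n, η i)) :=
          mul_le_mul_of_nonneg_left ih (by linarith [hη1 n])
        _ ≤ Real.exp (-η n) * (c 0 * Real.exp (-∑ i ∈ Finset.range n, η i)) := by
          refine mul_le_mul_of_nonneg_right (Real.one_sub_le_exp_neg _) ?_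
          exact mul_nonneg (hc 0) (Real.exp_pos _).le
        _ = c 0 * Real.exp (-∑ i ∈ Finset.range (n + 1), η i) := by
          rw [Finset.sum_range_succ, neg_add, Real.exp_add]; ring
  have h1 := (not_summable_iff_tendsto_nat_atTop_of_nonneg hη).1 hs
  have h2 : Tendsto (fun n => c 0 * Real.exp (-∑ i ∈ Finset.range n, η i)) atTop (𝓝 (c 0 * 0)) :=
    (Real.tendsto_exp_neg_atTop_nhds_zero.comp h1).const_mul _
  rw [mul_zero] at h2
  exact squeeze_zero hc key h2

section

variable {E : Type*} [NormedAddCommGroup E] [NormedSpace ℝ E] {η : ℕ → ℝ}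

/-- The excess of ‖z‖ over ε is contracted by the factor 1 - η at each step, so the previous lemma
applies to its positive part. -/
theorem eventually_norm_le_of_average {z r : ℕ → E} (hη : ∀ n, 0 < η n)
    (hη0 : Tendsto η atTop (𝓝 0)) (hs : ¬ Summable η)
    (h : ∀ n, z (n + 1) = (1 - η (n + 1)) • z n + η (n + 1) • r n)
    {ε ε' : ℝ} (hr : ∀ᶠ n in atTop, ‖r n‖ ≤ ε) (hε : ε < ε') : ∀ᶠ n in atTop, ‖z n‖ ≤ ε' := by
  obtain ⟨N, hN⟩ := eventually_atTop.1
    (hr.and ((hη0.eventually (gt_mem_nhds one_pos))))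
  have hlim : Tendsto (fun n => max (‖z (n + N)‖ - ε) 0) atTop (𝓝 0) := by
    -- The recursion for index n contracts with η (n + 1), hence the shift by N + 1 instead of N.
    refine tendsto_zero_of_le_one_sub_mul (η := fun n => η (n + (N + 1))) (fun n => (hη _).le)
      (fun n => (hN _ (by omega)).2.le) ?_ (fun n => le_max_right _ _) ?_
    · rwa [summable_nat_add_iff (f := η)]
    · intro n
      have h0 : 0 ≤ 1 - η (n + (N + 1)) := by linarith [(hN (n + (N + 1)) (by omega)).2]
      refine max_le ?_ (mul_nonneg h0 (le_max_right _ _))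
      have e1 : n + 1 + N = (n + N) + 1 := by ring
      have e2 : n + (N + 1) = (n + N) + 1 := by ring
      rw [e2] at h0 ⊢
      rw [e1, h]
      have h1 : ‖(1 - η (n + N + 1)) • z (n + N) + η (n + N + 1) • r (n + N)‖ ≤
          (1 - η (n + N + 1)) * ‖z (n + N)‖ + η (n + N + 1) * ε := by
        refine (norm_add_le _ _).trans ?_
        rw [norm_smul, norm_smul, Real.norm_of_nonneg h0, Real.norm_of_nonneg (hη _).le]
        gcongr
        · exact (hη _).le
        · exact (hN _ (by omega)).1
      have h2 := mul_le_mul_of_nonneg_left (le_max_left (‖z (n + N)‖ - ε) 0) h0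
      linarith
  have h3 := hlim.eventually (gt_mem_nhds (sub_pos.2 hε))
  obtain ⟨N', hN'⟩ := eventually_atTop.1 h3
  refine eventually_atTop.2 ⟨N' + N, fun n hn => ?_⟩
  have := (le_max_left (‖z (n - N + N)‖ - ε) 0).trans_lt (hN' (n - N) (by omega))
  rw [Nat.sub_add_cancel (by omega)] at this
  linarith

/-- A convergent series of perturbations is absorbed by adding its tail R n to y n: the sum obeys
the unperturbed recursion with input R n + r n, and R n tends to 0. -/
theorem eventually_norm_le_of_average_add {y s r : ℕ → E} {l : E} (hη : ∀ n, 0 < η n)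
    (hη0 : Tendsto η atTop (𝓝 0)) (hs : ¬ Summable η)
    (hsum : Tendsto (fun n => ∑ i ∈ Finset.range n, s i) atTop (𝓝 l))
    (h : ∀ n, y (n + 1) = (1 - η (n + 1)) • y n + s n + η (n + 1) • r n)
    {ε ε' : ℝ} (hr : ∀ᶠ n in atTop, ‖r n‖ ≤ ε) (hε : ε < ε') : ∀ᶠ n in atTop, ‖y n‖ ≤ ε' := by
  set R : ℕ → E := fun n => l - ∑ i ∈ Finset.range n, s i with hR
  have hR0 : Tendsto (fun n => ‖R n‖) atTop (𝓝 0) := by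
    have := (tendsto_const_nhds (x := l)).sub hsum
    rw [sub_self] at this
    simpa using this.norm
  obtain ⟨γ, hγ, hγε⟩ : ∃ γ > 0, ε + 3 * γ = ε' := ⟨(ε' - ε) / 3, by linarith, by ring⟩
  have hRγ := hR0.eventually (gt_mem_nhds hγ)
  have hz := eventually_norm_le_of_average (z := fun n => y n + R n) (r := fun n => R n + r n)
    hη hη0 hs (by
      intro n
      simp only [h, hR, Finset.sum_range_succ]
      module) (ε := ε + γ) (ε' := ε + 2 * γ) (by
      filter_upwards [hr, hRγ] with n h1 h2
      exact (norm_add_le _ _).trans (by linarith)) (by linarith)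
  filter_upwards [hz, hRγ] with n h1 h2
  have : ‖y n‖ ≤ ‖y n + R n‖ + ‖R n‖ := by
    simpa using norm_sub_le (y n + R n) (R n)
  linarith

end

/-- The growth bound on 1 / η says that i^(-ϱ) = O(η), and Σ i^(-ϱ) diverges because ϱ < 1. -/
theorem StepSizeAssumptions.not_summable_η {η μ : ℕ → ℝ} (h : StepSizeAssumptions η μ) :
    ¬ Summable η := by
  obtain ⟨ϱ, h0, h1, hO⟩ := h.inv_η
  intro hs
  have h2 : (fun i : ℕ => ((i : ℝ) ^ ϱ)⁻¹) =O[atTop] η := by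
    have := hO.inv_rev (Eventually.of_forall fun i hi => by
      simp [(h.pos_η i).ne'] at hi)
    simpa using this
  have h3 := summable_of_isBigO_nat hs h2
  rw [Real.summable_nat_rpow_inv] at h3
  linarith

theorem StepSizeAssumptions.summable_sub {η μ : ℕ → ℝ} (h : StepSizeAssumptions η μ) :
    Summable (fun i => η i - η (i + 1)) := by
  have := (h.tendsto_η.const_sub (η 0))
  rw [sub_zero] at this
  refine (hasSum_iff_tendsto_nat_of_nonneg
    (fun i => sub_nonneg.2 (h.antitone_η (Nat.le_succ i))) (η 0)).2 ?_ |>.summable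
  exact this.congr fun n => (Finset.sum_range_sub' η n).symm

section

variable {E : Type*} [NormedAddCommGroup E] [NormedSpace ℝ E] [CompleteSpace E] {η μ : ℕ → ℝ}

/-- The algorithm forgets at rate η (i + 1) but adds the new sample with weight η i. The lemma shows
that this mismatch is a summable perturbation for bounded quantities. -/
theorem StepSizeAssumptions.summable_sub_smul (h : StepSizeAssumptions η μ) {v : ℕ → E} {b : ℝ}
    (hv : ∀ i, ‖v i‖ ≤ b) : Summable (fun i => (η i - η (i + 1)) • v i) := by
  refine Summable.of_norm_bounded (h.summable_sub.mul_right b) fun i => ?_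
  have h0 : 0 ≤ η i - η (i + 1) := sub_nonneg.2 (h.antitone_η (Nat.le_succ i))
  rw [norm_smul, Real.norm_of_nonneg h0]
  exact mul_le_mul_of_nonneg_left (hv i) h0

/-- Abel summation against a monotone sequence. -/
theorem StepSizeAssumptions.exists_tendsto_sum_smul_sub (h : StepSizeAssumptions η μ) {u : ℕ → E}
    {b : ℝ} (hu : ∀ i, ‖u i‖ ≤ b) :
    ∃ l, Tendsto (fun n => ∑ i ∈ Finset.range n, η i • (u i - u (i + 1))) atTop (𝓝 l) := by
  have key : ∀ n, ∑ i ∈ Finset.range n, η i • (u i - u (i + 1)) =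
      η 0 • u 0 - η n • u n - ∑ i ∈ Finset.range n, (η i - η (i + 1)) • u (i + 1) := by
    intro n
    induction n with
    | zero => simp
    | succ n ih =>
      rw [Finset.sum_range_succ, Finset.sum_range_succ, ih]
      module
  have h1 : Tendsto (fun n => η n • u n) atTop (𝓝 0) := by
    refine squeeze_zero_norm (a := fun n => η n * b) (fun n => ?_) ?_
    · rw [norm_smul, Real.norm_of_nonneg (h.pos_η n).le]
      exact mul_le_mul_of_nonneg_left (hu n) (h.pos_η n).le
    · simpa using h.tendsto_η.mul_const b
  have h2 := (h.summable_sub_smul (v := fun i => u (i + 1)) (fun i => hu _)).hasSum.tendsto_sum_nat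
  exact ⟨_, ((h1.const_sub (η 0 • u 0)).sub h2).congr fun n => (key n).symm⟩

/-- An averaged estimate tracks a slowly varying target up to the asymptotic bias `r`. -/
theorem StepSizeAssumptions.limsup_tracking (h : StepSizeAssumptions η μ)
    {est β m r : ℕ → E} {b L : ℝ} (hm : ∀ i, ‖m i‖ ≤ b)
    (hslow : ∀ i, ‖m (i + 1) - m i‖ ≤ L * μ (i + 1))
    (hrec : ∀ i, est (i + 1) = (1 - η (i + 1)) • est i + η i • β i)
    (hsum : ∃ l, Tendsto (fun n => ∑ i ∈ Finset.range n, η i • (β i - m i - r i)) atTop (𝓝 l)) :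
    limsup (fun i => ‖est i - m i‖ₑ) atTop ≤ limsup (fun i => ‖r i‖ₑ) atTop := by
  obtain ⟨l, hl⟩ := hsum
  -- Comparing with an arbitrary c above the right-hand side disposes of an infinite limsup. For a
  -- finite one, r is eventually bounded, hence bounded, as the step-size mismatch term for r
  -- requires.
  refine le_of_forall_gt fun c hc => ?_
  obtain ⟨c', hc1, hc2⟩ := exists_between hc
  have hc't : c' ≠ ⊤ := ne_top_of_lt hc2
  have hr : ∀ᶠ i in atTop, ‖r i‖ ≤ c'.toReal := by
    filter_upwards [eventually_lt_of_limsup_lt hc1] with i hi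
    rw [← toReal_enorm]
    exact ENNReal.toReal_mono hc't hi.le
  obtain ⟨N, hN⟩ := eventually_atTop.1 hr
  obtain ⟨b', hb'⟩ : ∃ b', ∀ i, ‖r i‖ ≤ b' := by
    have h1 : BddAbove (Set.range fun i => ‖r i‖) := by
      refine Filter.IsBoundedUnder.bddAbove_range ⟨c'.toReal, ?_⟩
      simpa using hr
    obtain ⟨b', hb'⟩ := h1
    exact ⟨b', fun i => hb' ⟨i, rfl⟩⟩
  have s1 := (h.summable_sub_smul hm).hasSum.tendsto_sum_nat
  have s2 := (h.summable_sub_smul hb').hasSum.tendsto_sum_nat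
  -- The drift of the target, measured in units of η; it vanishes because μ / η does.
  set q : ℕ → E := fun i => (η (i + 1))⁻¹ • (m i - m (i + 1)) with hq
  have hq0 : Tendsto q atTop (𝓝 0) := by
    refine squeeze_zero_norm (a := fun i => L * (μ (i + 1) * (η (i + 1))⁻¹)) (fun i => ?_) ?_
    · rw [hq]
      simp only
      rw [norm_smul, norm_inv, Real.norm_of_nonneg (h.pos_η _).le, norm_sub_rev, mul_comm,
        ← mul_assoc]
      exact mul_le_mul_of_nonneg_right (hslow i) (inv_nonneg.2 (h.pos_η _).le)
    · simpa using ((tendsto_add_atTop_iff_nat 1).2 h.tendsto_ratio).const_mul L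
  have hq' : Tendsto (fun i => ‖q i‖) atTop (𝓝 0) := by simpa using hq0.norm
  obtain ⟨c'', hc3, hc4⟩ := exists_between hc2
  have hc''t : c'' ≠ ⊤ := ne_top_of_lt hc4
  have hlt : c'.toReal < c''.toReal := (ENNReal.toReal_lt_toReal hc't hc''t).2 hc3
  obtain ⟨γ, hγ, hγc⟩ : ∃ γ > 0, c'.toReal + 2 * γ = c''.toReal :=
    ⟨(c''.toReal - c'.toReal) / 2, by linarith, by ring⟩
  -- The error est - m is itself an average: its inputs are the bias r and the drift q, and the
  -- perturbations are the assumed convergent series together with the two step-size mismatches.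
  have hfin := eventually_norm_le_of_average_add (y := fun i => est i - m i)
    (s := fun i => η i • (β i - m i - r i) + (η i - η (i + 1)) • m i + (η i - η (i + 1)) • r i)
    (r := fun i => r i + q i) (l := l + _ + _) h.pos_η h.tendsto_η h.not_summable_η
    (by
      simp only [Finset.sum_add_distrib]
      exact (hl.add s1).add s2)
    (by
      intro n
      have : η (n + 1) • q n = m n - m (n + 1) := by
        rw [hq]; simp only; rw [smul_smul, mul_inv_cancel₀ (h.pos_η _).ne', one_smul]
      rw [smul_add, this, hrec]
      module)
    (ε := c'.toReal + γ) (ε' := c''.toReal)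
    (by
      filter_upwards [hr, hq'.eventually (gt_mem_nhds hγ)] with n h1 h2
      exact (norm_add_le _ _).trans (by linarith)) (by linarith)
  refine (limsup_le_of_le (by isBoundedDefault) (a := c'') ?_).trans_lt hc4
  filter_upwards [hfin] with i hi
  rw [← ofReal_norm, ← ENNReal.ofReal_toReal hc''t]
  exact ENNReal.ofReal_le_ofReal hi

end

end CACRL

namespace CACRL

/-! ### Conditional laws and martingale noise -/

/-- If the conditional law of `Y` given `m` is `κ (W ·)` with `W` known, then conditional
expectations of functions of `(W, Y)` are integrals against `κ (W ·)`. -/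
theorem condExp_eq_integral_kernel {Ω β Γ E : Type*} {m mΩ : MeasurableSpace Ω} {P : Measure Ω}
    [IsProbabilityMeasure P] [MeasurableSpace β] [MeasurableSpace Γ]
    [NormedAddCommGroup E] [NormedSpace ℝ E] [CompleteSpace E] (hm : m ≤ mΩ)
    {W : Ω → Γ} (hW : Measurable[m] W) {Y : Ω → β} (hY : Measurable Y) (κ : Kernel Γ β)
    [IsMarkovKernel κ]
    (h : ∀ U, MeasurableSet U →
      P[(Y ⁻¹' U).indicator (fun _ => (1 : ℝ)) | m] =ᵐ[P] fun ω => (κ (W ω)).real U)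
    {G : Γ × β → E} (hG : StronglyMeasurable G) {b : ℝ} (hb : ∀ q, ‖G q‖ ≤ b) :
    P[fun ω => G (W ω, Y ω) | m] =ᵐ[P] fun ω => ∫ y, G (W ω, y) ∂κ (W ω) := by
  have hW' : Measurable W := hW.mono hm le_rfl
  -- The conditional law determines the joint law of (W, Y) on every m-measurable event. Rectangles
  -- suffice, by the defining property of the conditional expectation on W⁻¹' A ∩ s. General G then
  -- needs no approximation by simple functions.
  have hmap : ∀ s, MeasurableSet[m] s →
      (P.restrict s).map (fun ω => (W ω, Y ω)) = ((P.restrict s).map W) ⊗ₘ κ := by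
    intro s hs
    refine Measure.ext_prod fun {A U} hA hU => ?_
    rw [Measure.map_apply (hW'.prodMk hY) (hA.prod hU), Measure.compProd_apply_prod hA hU,
      ← lintegral_indicator hA, lintegral_map ((κ.measurable_coe hU).indicator hA) hW',
      Measure.restrict_apply ((hW'.prodMk hY) (hA.prod hU))]
    have e1 : (fun ω => (W ω, Y ω)) ⁻¹' A ×ˢ U ∩ s = Y ⁻¹' U ∩ (W ⁻¹' A ∩ s) := by
      ext ω; simp only [mem_inter_iff, mem_preimage, mem_prod]; tauto
    have hs' : MeasurableSet[m] (W ⁻¹' A ∩ s) := (hW hA).inter hs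
    have h1 := setIntegral_condExp (μ := P) hm
      (f := (Y ⁻¹' U).indicator (fun _ => (1 : ℝ)))
      ((integrable_const _).indicator (hY hU)) hs'
    rw [setIntegral_congr_ae (hm _ hs') ((h U hU).mono fun ω hω _ => hω),
      integral_indicator (hY hU), integral_const, smul_eq_mul, mul_one, measureReal_restrict_apply_univ,
      measureReal_restrict_apply (hY hU)] at h1
    have e2 : ∀ ω, A.indicator (fun a => κ a U) (W ω) =
        (W ⁻¹' A).indicator (fun ω => κ (W ω) U) ω := fun ω => rfl
    have hκ : Measurable fun ω => κ (W ω) U := (κ.measurable_coe hU).comp hW'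
    simp_rw [e2]
    rw [e1, lintegral_indicator (hW' hA), Measure.restrict_restrict (hW' hA),
      ← ENNReal.toReal_eq_toReal_iff' (measure_ne_top _ _), ← integral_toReal hκ.aemeasurable
        (Eventually.of_forall fun ω => measure_lt_top _ _)]
    · exact h1.symm
    · refine ((lintegral_mono fun ω => prob_le_one).trans_lt ?_).ne
      rw [lintegral_one]
      exact measure_lt_top _ _
  have hint : Integrable (fun ω => G (W ω, Y ω)) P :=
    Integrable.of_bound (hG.comp_measurable (hW'.prodMk hY)).aestronglyMeasurable b
      (Eventually.of_forall fun ω => hb _)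
  have hsm : StronglyMeasurable[m] (fun ω => ∫ y, G (W ω, y) ∂κ (W ω)) :=
    (hG.integral_kernel_prod_right' (κ := κ)).comp_measurable hW
  refine (ae_eq_condExp_of_forall_setIntegral_eq hm hint ?_ ?_ hsm.aestronglyMeasurable).symm
  · intro s hs _
    refine (Integrable.of_bound (hsm.mono hm).aestronglyMeasurable b
      (Eventually.of_forall fun ω => ?_)).integrableOn
    simpa using norm_integral_le_of_norm_le_const (μ := κ (W ω)) (Eventually.of_forall fun y => hb (W ω, y))
  · intro s hs _
    have h1 : ∫ ω in s, G (W ω, Y ω) ∂P = ∫ q, G q ∂((P.restrict s).map (fun ω => (W ω, Y ω))) :=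
      (integral_map (hW'.prodMk hY).aemeasurable hG.aestronglyMeasurable).symm
    rw [h1, hmap s hs, Measure.integral_compProd, integral_map hW'.aemeasurable]
    · exact (hG.integral_kernel_prod_right' (κ := κ)).aestronglyMeasurable
    · have : IsFiniteMeasure ((P.restrict s).map W) := inferInstance
      exact Integrable.of_bound hG.aestronglyMeasurable b (Eventually.of_forall hb)

section

variable {Ω : Type*} {mΩ : MeasurableSpace Ω} {P : Measure Ω} [IsProbabilityMeasure P]

/-- Almost sure convergence of series of bounded martingale differences with predictable,
square-summable weights. -/
theorem ae_exists_tendsto_sum_mul {ℱ : Filtration ℕ mΩ} {D c : ℕ → Ω → ℝ} {γ : ℕ → ℝ} {b : ℝ}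
    (hD : ∀ t, StronglyMeasurable[ℱ (t + 1)] (D t)) (hDb : ∀ t ω, |D t ω| ≤ b)
    (hD0 : ∀ t, P[D t | ℱ t] =ᵐ[P] 0) (hc : ∀ t, StronglyMeasurable[ℱ t] (c t))
    (hcγ : ∀ t ω, |c t ω| ≤ γ t) (hγ : Summable fun t => γ t ^ 2) :
    ∀ᵐ ω ∂P, ∃ l, Tendsto (fun n => ∑ t ∈ Finset.range n, c t ω * D t ω) atTop (𝓝 l) := by
  have hb : 0 ≤ b := by
    obtain ⟨ω⟩ : Nonempty Ω := nonempty_of_isProbabilityMeasure P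
    exact (abs_nonneg _).trans (hDb 0 ω)
  have hγ0 : ∀ t, 0 ≤ γ t := fun t => by
    obtain ⟨ω⟩ : Nonempty Ω := nonempty_of_isProbabilityMeasure P
    exact (abs_nonneg _).trans (hcγ t ω)
  set f : ℕ → Ω → ℝ := fun n ω => ∑ t ∈ Finset.range n, c t ω * D t ω with hf
  have hinc : ∀ t, StronglyMeasurable[ℱ (t + 1)] (fun ω => c t ω * D t ω) := fun t =>
    ((hc t).mono (ℱ.mono (Nat.le_succ t))).mul (hD t)
  have hincb : ∀ t ω, ‖c t ω * D t ω‖ ≤ γ t * b := fun t ω => by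
    rw [Real.norm_eq_abs, abs_mul]
    exact mul_le_mul (hcγ t ω) (hDb t ω) (abs_nonneg _) (hγ0 t)
  have hsm : ∀ n, StronglyMeasurable[ℱ n] (f n) := fun n =>
    Finset.stronglyMeasurable_fun_sum _ fun t ht =>
      (hinc t).mono (ℱ.mono (Finset.mem_range.1 ht))
  have hfb : ∀ n ω, ‖f n ω‖ ≤ ∑ t ∈ Finset.range n, γ t * b := fun n ω =>
    norm_sum_le_of_le _ fun t _ => hincb t ω
  have hsm' : ∀ n, AEStronglyMeasurable (f n) P := fun n =>
    ((hsm n).mono (ℱ.le n)).aestronglyMeasurable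
  have hint : ∀ n, Integrable (f n) P := fun n =>
    Integrable.of_bound (hsm' n) _ (Eventually.of_forall (hfb n))
  have hDint : ∀ t, Integrable (D t) P := fun t =>
    Integrable.of_bound (((hD t).mono (ℱ.le _)).aestronglyMeasurable) b
      (Eventually.of_forall (hDb t))
  have hincint : ∀ t, Integrable (fun ω => c t ω * D t ω) P := fun t =>
    Integrable.of_bound (((hinc t).mono (ℱ.le _)).aestronglyMeasurable) _
      (Eventually.of_forall (hincb t))
  have hcond : ∀ t, P[fun ω => c t ω * D t ω | ℱ t] =ᵐ[P] 0 := fun t => by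
    refine (condExp_stronglyMeasurable_mul_of_bound (ℱ.le t) (hc t) (hDint t) (γ t)
      (Eventually.of_forall (hcγ t))).trans ?_
    filter_upwards [hD0 t] with ω hω
    simp [hω]
  have hmart : Martingale f ℱ P := by
    refine martingale_nat hsm hint fun n => ?_
    have e : f (n + 1) = f n + fun ω => c n ω * D n ω := by
      ext ω; simp [hf, Finset.sum_range_succ]
    rw [e]
    refine ((condExp_add (hint n) (hincint n) (ℱ n)).trans ?_).symm
    rw [condExp_of_stronglyMeasurable (ℱ.le n) (hsm n) (hint n)]
    filter_upwards [hcond n] with ω hω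
    simp [hω]
  -- Martingale increments are orthogonal, so the second moments add up and stay below a convergent
  -- series.
  have hL2 : ∀ n, ∫ ω, f n ω ^ 2 ∂P ≤ ∑ t ∈ Finset.range n, γ t ^ 2 * b ^ 2 := by
    intro n
    induction n with
    | zero => simp [hf]
    | succ n ih =>
      have hcross : ∫ ω, f n ω * (c n ω * D n ω) ∂P = 0 := by
        have h1 : P[fun ω => f n ω * (c n ω * D n ω) | ℱ n] =ᵐ[P] 0 := by
          refine (condExp_stronglyMeasurable_mul_of_bound (ℱ.le n) (hsm n) (hincint n) _
            (Eventually.of_forall (hfb n))).trans ?_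
          filter_upwards [hcond n] with ω hω
          simp [hω]
        rw [← integral_condExp (ℱ.le n), integral_congr_ae h1]
        simp
      have i1 : Integrable (fun ω => f n ω ^ 2) P :=
        Integrable.of_bound ((hsm' n).pow 2) ((∑ t ∈ Finset.range n, γ t * b) ^ 2)
          (Eventually.of_forall fun ω => by
            rw [norm_pow]; exact pow_le_pow_left₀ (norm_nonneg _) (hfb n ω) 2)
      have i3 : Integrable (fun ω => (c n ω * D n ω) ^ 2) P :=
        Integrable.of_bound ((hincint n).aestronglyMeasurable.pow 2) ((γ n * b) ^ 2)
          (Eventually.of_forall fun ω => by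
            rw [norm_pow]; exact pow_le_pow_left₀ (norm_nonneg _) (hincb n ω) 2)
      have i2 : Integrable (fun ω => 2 * (f n ω * (c n ω * D n ω))) P :=
        ((hincint n).bdd_mul (hsm' n) (Eventually.of_forall (hfb n))).const_mul 2
      have e : ∀ ω, f (n + 1) ω ^ 2 =
          f n ω ^ 2 + 2 * (f n ω * (c n ω * D n ω)) + (c n ω * D n ω) ^ 2 := fun ω => by
        simp only [hf, Finset.sum_range_succ]; ring
      simp_rw [e]
      rw [integral_add (f := fun ω => f n ω ^ 2 + 2 * (f n ω * (c n ω * D n ω))) (i1.add i2) i3,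
        integral_add i1 i2, integral_const_mul, hcross,
        Finset.sum_range_succ]
      have : ∫ ω, (c n ω * D n ω) ^ 2 ∂P ≤ ∫ _, γ n ^ 2 * b ^ 2 ∂P := by
        refine integral_mono i3 (integrable_const _) fun ω => ?_
        simp only
        rw [← mul_pow, ← sq_abs]
        exact pow_le_pow_left₀ (abs_nonneg _) (hincb n ω) 2
      rw [integral_const] at this
      simp at this
      linarith
  obtain ⟨S, hS⟩ : ∃ S, ∀ n, ∫ ω, f n ω ^ 2 ∂P ≤ S := by
    refine ⟨∑' t, γ t ^ 2 * b ^ 2, fun n => (hL2 n).trans ?_⟩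
    exact (hγ.mul_right (b ^ 2)).sum_le_tsum _ fun t _ => by positivity
  -- Doob's theorem asks for an L¹ bound; it follows from the L² bound through |x| ≤ 1 + x².
  refine hmart.submartingale.exists_ae_tendsto_of_bdd (R := (1 + S).toNNReal) fun n => ?_
  rw [eLpNorm_one_eq_lintegral_enorm, ← ofReal_integral_norm_eq_lintegral_enorm (hint n)]
  refine ENNReal.ofReal_le_ofReal ?_
  have i1 : Integrable (fun ω => f n ω ^ 2) P :=
    Integrable.of_bound ((hsm' n).pow 2) ((∑ t ∈ Finset.range n, γ t * b) ^ 2)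
      (Eventually.of_forall fun ω => by
        rw [norm_pow]; exact pow_le_pow_left₀ (norm_nonneg _) (hfb n ω) 2)
  calc ∫ ω, ‖f n ω‖ ∂P ≤ ∫ ω, (1 + f n ω ^ 2) ∂P := by
        refine integral_mono (hint n).norm ((integrable_const _).add i1) fun ω => ?_
        simp only [Real.norm_eq_abs]
        rw [← sq_abs]
        nlinarith [sq_nonneg (|f n ω| - 1), sq_nonneg (|f n ω|)]
    _ = 1 + ∫ ω, f n ω ^ 2 ∂P := by
        rw [integral_add (integrable_const _) i1]; simp
    _ ≤ 1 + S := by linarith [hS n]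

/-- Coordinates in a basis reduce the finite-dimensional case to the scalar one. -/
theorem ae_exists_tendsto_sum_smul {E : Type*} [NormedAddCommGroup E] [NormedSpace ℝ E]
    [FiniteDimensional ℝ E] {ℱ : Filtration ℕ mΩ} {D : ℕ → Ω → E}
    {c : ℕ → Ω → ℝ} {γ : ℕ → ℝ} {b : ℝ}
    (hD : ∀ t, StronglyMeasurable[ℱ (t + 1)] (D t)) (hDb : ∀ t ω, ‖D t ω‖ ≤ b)
    (hD0 : ∀ t, P[D t | ℱ t] =ᵐ[P] 0) (hc : ∀ t, StronglyMeasurable[ℱ t] (c t))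
    (hcγ : ∀ t ω, |c t ω| ≤ γ t) (hγ : Summable fun t => γ t ^ 2) :
    ∀ᵐ ω ∂P, ∃ l, Tendsto (fun n => ∑ t ∈ Finset.range n, c t ω • D t ω) atTop (𝓝 l) := by
  have : CompleteSpace E := FiniteDimensional.complete ℝ E
  set e := (Module.finBasis ℝ E).equivFunL with he
  have hj : ∀ j, ∀ᵐ ω ∂P, ∃ l, Tendsto
      (fun n => ∑ t ∈ Finset.range n, c t ω * e (D t ω) j) atTop (𝓝 l) := by
    intro j
    set φ : E →L[ℝ] ℝ := (ContinuousLinearMap.proj j).comp e.toContinuousLinearMap with hφ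
    refine ae_exists_tendsto_sum_mul (ℱ := ℱ) (D := fun t ω => φ (D t ω)) (b := ‖φ‖ * b)
      (fun t => φ.continuous.comp_stronglyMeasurable (hD t)) (fun t ω => ?_) (fun t => ?_) hc hcγ hγ
    · exact (φ.le_opNorm _).trans (mul_le_mul_of_nonneg_left (hDb t ω) (norm_nonneg _))
    · have hint : Integrable (D t) P :=
        Integrable.of_bound (((hD t).mono (ℱ.le _)).aestronglyMeasurable) b
          (Eventually.of_forall (hDb t))
      have := φ.comp_condExp_comm hint (m := ℱ t)
      refine this.symm.trans ?_
      filter_upwards [hD0 t] with ω hω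
      simp [hω]
  filter_upwards [ae_all_iff.2 hj] with ω hω
  choose l hl using hω
  refine ⟨e.symm l, ?_⟩
  have h1 : Tendsto (fun n => e (∑ t ∈ Finset.range n, c t ω • D t ω)) atTop (𝓝 l) := by
    rw [tendsto_pi_nhds]
    intro j
    refine (hl j).congr fun n => ?_
    simp [map_sum]
  simpa only [Function.comp_def, e.symm_apply_apply] using (e.symm.continuous.tendsto l).comp h1

end

end CACRL

namespace CACRL

/-! ### Total variation and the Poisson equation of a uniformly ergodic family -/

/-- Both measures have densities with respect to α + β; the difference of the integrals is the
integral of f against the difference of these densities. -/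
theorem norm_integral_sub_integral_le_tvDist {X E : Type*} [MeasurableSpace X]
    [NormedAddCommGroup E] [NormedSpace ℝ E] {α β : Measure X} [IsFiniteMeasure α]
    [IsFiniteMeasure β] {f : X → E} (hf : StronglyMeasurable f) {b : ℝ} (hb : ∀ x, ‖f x‖ ≤ b)
    {τ : ℝ} (hb0 : 0 ≤ b) (hτ : 0 ≤ τ) (h : tvDist α β ≤ ENNReal.ofReal τ) :
    ‖∫ x, f x ∂α - ∫ x, f x ∂β‖ ≤ b * τ := by
  have hα : α ≪ α + β := Measure.AbsolutelyContinuous.rfl.add_right β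
  have hβ : β ≪ α + β := Measure.AbsolutelyContinuous.rfl.add_right' α
  have iα : Integrable f α := Integrable.of_bound hf.aestronglyMeasurable b (Eventually.of_forall hb)
  have iβ : Integrable f β := Integrable.of_bound hf.aestronglyMeasurable b (Eventually.of_forall hb)
  rw [← integral_rnDeriv_smul hα, ← integral_rnDeriv_smul hβ,
    ← integral_sub ((integrable_rnDeriv_smul_iff hα).2 iα) ((integrable_rnDeriv_smul_iff hβ).2 iβ)]
  simp_rw [← sub_smul]
  have hint : Integrable (fun x => (α.rnDeriv (α + β) x).toReal - (β.rnDeriv (α + β) x).toReal)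
      (α + β) := Measure.integrable_toReal_rnDeriv.sub Measure.integrable_toReal_rnDeriv
  calc _ ≤ ∫ x, b * ‖(α.rnDeriv (α + β) x).toReal - (β.rnDeriv (α + β) x).toReal‖ ∂(α + β) := by
        refine norm_integral_le_of_norm_le (hint.norm.const_mul b)
          (Eventually.of_forall fun x => ?_)
        rw [norm_smul, mul_comm]
        exact mul_le_mul_of_nonneg_right (hb x) (norm_nonneg _)
    _ ≤ b * τ := by
        rw [integral_const_mul]
        refine mul_le_mul_of_nonneg_left ?_ hb0
        rw [← ENNReal.ofReal_le_ofReal_iff hτ, ofReal_integral_norm_eq_lintegral_enorm hint]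
        exact h

section

variable {T X E : Type*} [PseudoMetricSpace T] [MeasurableSpace T] [MeasurableSpace X]
  [NormedAddCommGroup E] [NormedSpace ℝ E]

/-- `F` is jointly measurable and bounded by `b`. -/
structure IsBddMeas (F : T → X → E) (b : ℝ) : Prop where
  meas : StronglyMeasurable (Function.uncurry F)
  le : ∀ θ x, ‖F θ x‖ ≤ b

/-- `F θ x` is uniformly continuous in `θ`, uniformly in `x`. -/
def IsUnifCont (F : T → X → E) : Prop :=
  ∀ ε > 0, ∃ δ > 0, ∀ θ θ', dist θ θ' < δ → ∀ x, ‖F θ x - F θ' x‖ ≤ ε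

omit [MeasurableSpace T] [MeasurableSpace X] [NormedSpace ℝ E] in
-- Closure under uniform limits: stationary means and Poisson solutions are known only as limits,
-- and inherit their continuity in θ this way.
theorem IsUnifCont.of_approx {F : T → X → E}
    (h : ∀ ε > 0, ∃ G : T → X → E, IsUnifCont G ∧ ∀ θ x, ‖F θ x - G θ x‖ ≤ ε) : IsUnifCont F := by
  intro ε hε
  obtain ⟨G, hG, hFG⟩ := h (ε / 3) (by positivity)
  obtain ⟨δ, hδ, hGδ⟩ := hG (ε / 3) (by positivity)
  refine ⟨δ, hδ, fun θ θ' hθ x => ?_⟩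
  have h1 := hFG θ x
  have h2 := hGδ θ θ' hθ x
  have h3 := hFG θ' x
  rw [norm_sub_rev] at h3
  have : F θ x - F θ' x = (F θ x - G θ x) + (G θ x - G θ' x) + (G θ' x - F θ' x) := by abel
  rw [this]
  exact (norm_add₃_le).trans (by linarith)

omit [MeasurableSpace T] [MeasurableSpace X] [NormedSpace ℝ E] in
theorem IsUnifCont.add {F G : T → X → E} (hF : IsUnifCont F) (hG : IsUnifCont G) :
    IsUnifCont fun θ x => F θ x + G θ x := by
  intro ε hε
  obtain ⟨δ, hδ, h1⟩ := hF (ε / 2) (by positivity)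
  obtain ⟨δ', hδ', h2⟩ := hG (ε / 2) (by positivity)
  refine ⟨min δ δ', lt_min hδ hδ', fun θ θ' hθ x => ?_⟩
  rw [add_sub_add_comm]
  exact (norm_add_le _ _).trans (by
    linarith [h1 θ θ' (hθ.trans_le (min_le_left _ _)) x, h2 θ θ' (hθ.trans_le (min_le_right _ _)) x])

omit [MeasurableSpace T] [MeasurableSpace X] [NormedSpace ℝ E] in
theorem IsUnifCont.neg {F : T → X → E} (hF : IsUnifCont F) : IsUnifCont fun θ x => - F θ x := by
  intro ε hε
  obtain ⟨δ, hδ, h1⟩ := hF ε hε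
  refine ⟨δ, hδ, fun θ θ' hθ x => ?_⟩
  rw [neg_sub_neg, norm_sub_rev]
  exact h1 θ θ' hθ x

omit [MeasurableSpace T] [MeasurableSpace X] [NormedSpace ℝ E] in
theorem IsUnifCont.sum {F : ℕ → T → X → E} (hF : ∀ t, IsUnifCont (F t)) (n : ℕ) :
    IsUnifCont fun θ x => ∑ t ∈ Finset.range n, F t θ x := by
  induction n with
  | zero => intro ε hε; exact ⟨1, one_pos, fun θ θ' _ x => by simpa using hε.le⟩
  | succ n ih => simp_rw [Finset.sum_range_succ]; exact ih.add (hF n)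

/-- The action of the kernels on functions. -/
noncomputable def push (κ : Kernel (T × X) X) (F : T → X → E) : T → X → E :=
  fun θ x => ∫ y, F θ y ∂κ (θ, x)

/-- A family of Markov kernels `κ (θ, ·)` with stationary laws `d θ`, whose `t`-step kernels
`N θ t` converge geometrically in total variation. -/
structure IsErgodicFamily (κ : Kernel (T × X) X) (d : T → Measure X) (N : T → ℕ → Kernel X X)
    (c ρ : ℝ) : Prop where
  isMarkov : IsMarkovKernel κ
  isProb : ∀ θ, IsProbabilityMeasure (d θ)
  isMarkov_iter : ∀ θ t, IsMarkovKernel (N θ t)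
  invariant : ∀ θ, (κ.sectR θ).Invariant (d θ)
  zero : ∀ θ, N θ 0 = Kernel.id
  succ : ∀ θ t, N θ (t + 1) = κ.sectR θ ∘ₖ N θ t
  tv : ∀ θ x t, tvDist (N θ t x) (d θ) ≤ ENNReal.ofReal (c * ρ ^ t)
  c_nonneg : 0 ≤ c
  ρ_nonneg : 0 ≤ ρ
  ρ_lt_one : ρ < 1

variable {κ : Kernel (T × X) X} {d : T → Measure X} {N : T → ℕ → Kernel X X} {c ρ : ℝ}
  {F : T → X → E} {b : ℝ}

omit [PseudoMetricSpace T] [NormedSpace ℝ E] in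
theorem IsBddMeas.sm (hF : IsBddMeas F b) (θ : T) : StronglyMeasurable (F θ) :=
  hF.meas.comp_measurable measurable_prodMk_left

omit [PseudoMetricSpace T] [NormedSpace ℝ E] in
theorem IsBddMeas.integrable (hF : IsBddMeas F b) (θ : T) (ν : Measure X) [IsFiniteMeasure ν] :
    Integrable (F θ) ν :=
  Integrable.of_bound (hF.sm θ).aestronglyMeasurable b (Eventually.of_forall (hF.le θ))

omit [PseudoMetricSpace T] in
theorem IsBddMeas.norm_integral_le (hF : IsBddMeas F b) (θ : T) (ν : Measure X)
    [IsProbabilityMeasure ν] : ‖∫ x, F θ x ∂ν‖ ≤ b := by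
  simpa using norm_integral_le_of_norm_le_const (μ := ν) (Eventually.of_forall (hF.le θ))

omit [PseudoMetricSpace T] [NormedSpace ℝ E] in
theorem IsBddMeas.add {G : T → X → E} {b' : ℝ} (hF : IsBddMeas F b) (hG : IsBddMeas G b') :
    IsBddMeas (fun θ x => F θ x + G θ x) (b + b') :=
  ⟨hF.meas.add hG.meas, fun θ x => (norm_add_le _ _).trans (add_le_add (hF.le θ x) (hG.le θ x))⟩

omit [PseudoMetricSpace T] in
theorem IsBddMeas.push (hκ : IsMarkovKernel κ) (hF : IsBddMeas F b) : IsBddMeas (push κ F) b := by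
  refine ⟨?_, fun θ x => hF.norm_integral_le θ _⟩
  exact StronglyMeasurable.integral_kernel_prod_right (κ := κ) (f := fun q y => F q.1 y)
    (hF.meas.comp_measurable (g := fun q : (T × X) × X => (q.1.1, q.2)) (by fun_prop))

omit [PseudoMetricSpace T] in
theorem IsBddMeas.push_iterate (hκ : IsMarkovKernel κ) (hF : IsBddMeas F b) (t : ℕ) :
    IsBddMeas ((CACRL.push κ)^[t] F) b := by
  induction t with
  | zero => exact hF
  | succ t ih => rw [Function.iterate_succ_apply']; exact ih.push hκ

/-- The change splits into that of the integrand under a fixed kernel and that of the kernel. The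
Lipschitz hypothesis covers all bounded measurable functions because F has no regularity in the
state. -/
theorem IsUnifCont.push [CompleteSpace E] (hκ : IsMarkovKernel κ)
    (hlip : ∃ L, ∀ (f : X → E) (b : ℝ), StronglyMeasurable f → (∀ x, ‖f x‖ ≤ b) → ∀ θ θ' x,
      ‖∫ y, f y ∂κ (θ, x) - ∫ y, f y ∂κ (θ', x)‖ ≤ L * b * dist θ θ')
    (hF : IsBddMeas F b) (hU : IsUnifCont F) : IsUnifCont (push κ F) := by
  obtain ⟨L, hL⟩ := hlip
  intro ε hε
  obtain ⟨δ, hδ, h1⟩ := hU (ε / 2) (by positivity)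
  have hpos : 0 < |L * b| + 1 := by positivity
  refine ⟨min δ (ε / 2 / (|L * b| + 1)), lt_min hδ (by positivity), fun θ θ' hθ x => ?_⟩
  have e : CACRL.push κ F θ x - CACRL.push κ F θ' x =
      ∫ y, (F θ y - F θ' y) ∂κ (θ, x) + (∫ y, F θ' y ∂κ (θ, x) - ∫ y, F θ' y ∂κ (θ', x)) := by
    rw [integral_sub (hF.integrable θ _) (hF.integrable θ' _)]
    simp only [CACRL.push]
    abel
  have h2 : ‖∫ y, (F θ y - F θ' y) ∂κ (θ, x)‖ ≤ ε / 2 := by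
    simpa using norm_integral_le_of_norm_le_const (μ := κ (θ, x))
      (Eventually.of_forall (h1 θ θ' (hθ.trans_le (min_le_left _ _))))
  have h3 := hL (F θ') b (hF.sm θ') (hF.le θ') θ θ' x
  have h4 : L * b * dist θ θ' ≤ ε / 2 := by
    have h5 : dist θ θ' ≤ ε / 2 / (|L * b| + 1) := hθ.le.trans (min_le_right _ _)
    rw [le_div_iff₀ hpos] at h5
    have h6 : L * b ≤ |L * b| + 1 := (le_abs_self _).trans (by linarith)
    calc L * b * dist θ θ' ≤ (|L * b| + 1) * dist θ θ' :=
          mul_le_mul_of_nonneg_right h6 dist_nonneg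
      _ ≤ ε / 2 := by linarith
  rw [e]
  exact (norm_add_le _ _).trans (by linarith)

/-- The solution of the Poisson equation. -/
noncomputable def poisson (κ : Kernel (T × X) X) (d : T → Measure X) (F : T → X → E) : T → X → E :=
  fun θ x => ∑' t, ((push κ)^[t] F θ x - ∫ y, F θ y ∂d θ)

namespace IsErgodicFamily

omit [PseudoMetricSpace T]

variable (h : IsErgodicFamily κ d N c ρ)
include h

omit [NormedSpace ℝ E] in
theorem b_nonneg (hF : IsBddMeas F b) [Nonempty T] : 0 ≤ b := by
  obtain ⟨θ⟩ := ‹Nonempty T›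
  have := h.isProb θ
  obtain ⟨x⟩ := nonempty_of_isProbabilityMeasure (d θ)
  exact (norm_nonneg _).trans (hF.le θ x)

theorem summable_bound (b : ℝ) : Summable fun t => b * (c * ρ ^ t) :=
  ((summable_geometric_of_lt_one h.ρ_nonneg h.ρ_lt_one).mul_left c).mul_left b

variable (hF : IsBddMeas F b) [CompleteSpace E]
include hF

theorem push_iterate_eq (t : ℕ) (θ : T) (x : X) :
    (push κ)^[t] F θ x = ∫ y, F θ y ∂N θ t x := by
  have := h.isMarkov
  have := h.isMarkov_iter
  induction t generalizing F with
  | zero => rw [h.zero, Kernel.id_apply, integral_dirac' _ _ (hF.sm θ)]; rfl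
  | succ t ih =>
    rw [Function.iterate_succ_apply, ih (hF.push h.isMarkov), h.succ,
      Kernel.integral_comp (hF.integrable θ _)]
    rfl

theorem norm_push_iterate_sub_le (t : ℕ) (θ : T) (x : X) :
    ‖(push κ)^[t] F θ x - ∫ y, F θ y ∂d θ‖ ≤ b * (c * ρ ^ t) := by
  have := h.isMarkov_iter
  have := h.isProb
  have : Nonempty T := ⟨θ⟩
  rw [h.push_iterate_eq hF]
  exact norm_integral_sub_integral_le_tvDist (hF.sm θ) (hF.le θ) (h.b_nonneg hF)
    (mul_nonneg h.c_nonneg (pow_nonneg h.ρ_nonneg t)) (h.tv θ x t)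

theorem tendsto_push_iterate (θ : T) (x : X) :
    Tendsto (fun t => (push κ)^[t] F θ x) atTop (𝓝 (∫ y, F θ y ∂d θ)) := by
  rw [tendsto_iff_norm_sub_tendsto_zero]
  exact squeeze_zero (fun t => norm_nonneg _) (fun t => h.norm_push_iterate_sub_le hF t θ x)
    (h.summable_bound b).tendsto_atTop_zero

/-- Nothing is assumed on how d depends on θ. Measurability comes from mixing: the stationary mean
is the limit of the iterates started at one fixed state. -/
theorem stronglyMeasurable_mean : StronglyMeasurable fun θ => ∫ y, F θ y ∂d θ := by
  rcases isEmpty_or_nonempty T with hT | ⟨⟨θ⟩⟩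
  · exact StronglyMeasurable.of_discrete
  have := h.isProb θ
  obtain ⟨x⟩ := nonempty_of_isProbabilityMeasure (d θ)
  refine stronglyMeasurable_of_tendsto atTop
    (f := fun t θ => (push κ)^[t] F θ x) (fun t => ?_) ?_
  · exact (hF.push_iterate h.isMarkov t).meas.comp_measurable measurable_prodMk_right
  · rw [tendsto_pi_nhds]
    exact fun θ => h.tendsto_push_iterate hF θ x

omit [CompleteSpace E] in
theorem invariant_integral (θ : T) :
    ∫ x, push κ F θ x ∂d θ = ∫ x, F θ x ∂d θ := by
  have := h.isMarkov
  have := h.isProb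
  have e := (h.invariant θ).comp_const
  obtain ⟨x⟩ := nonempty_of_isProbabilityMeasure (d θ)
  have e1 : (κ.sectR θ ∘ₖ Kernel.const X (d θ)) x = d θ := by rw [e, Kernel.const_apply]
  conv_rhs => rw [← e1]
  rw [Kernel.integral_comp (hF.integrable θ _), Kernel.const_apply]
  rfl

theorem summable_poisson (θ : T) (x : X) :
    Summable fun t => (push κ)^[t] F θ x - ∫ y, F θ y ∂d θ :=
  Summable.of_norm_bounded (h.summable_bound b) fun t => h.norm_push_iterate_sub_le hF t θ x

theorem isBddMeas_poisson : IsBddMeas (poisson κ d F) (∑' t, b * (c * ρ ^ t)) := by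
  refine ⟨?_, fun θ x => tsum_of_norm_bounded (h.summable_bound b).hasSum
    fun t => h.norm_push_iterate_sub_le hF t θ x⟩
  refine stronglyMeasurable_of_tendsto atTop
    (f := fun n (q : T × X) => ∑ t ∈ Finset.range n, ((push κ)^[t] F q.1 q.2 - ∫ y, F q.1 y ∂d q.1))
    (fun n => Finset.stronglyMeasurable_fun_sum _ fun t _ =>
      StronglyMeasurable.sub (f := fun q : T × X => (push κ)^[t] F q.1 q.2)
        (hF.push_iterate h.isMarkov t).meas
        ((h.stronglyMeasurable_mean hF).comp_measurable measurable_fst)) ?_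
  rw [tendsto_pi_nhds]
  exact fun q => (h.summable_poisson hF q.1 q.2).hasSum.tendsto_sum_nat

/-- The geometric bound allows series and integral to be exchanged for any probability ν. It is used
with ν a chain step and with ν the law of the next state given an action. -/
theorem integral_poisson (θ : T) (ν : Measure X) [IsProbabilityMeasure ν] :
    ∫ y, poisson κ d F θ y ∂ν =
      ∑' t, (∫ y, (push κ)^[t] F θ y ∂ν - ∫ y, F θ y ∂d θ) := by
  have hi : ∀ t, Integrable (fun y => (push κ)^[t] F θ y - ∫ y, F θ y ∂d θ) ν := fun t =>
    ((hF.push_iterate h.isMarkov t).integrable θ _).sub (integrable_const _)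
  have h2 := integral_tsum_of_summable_integral_norm hi
    (Summable.of_nonneg_of_le (fun t => by positivity) (fun t => ?_) (h.summable_bound b))
  · refine h2.symm.trans (tsum_congr fun t => ?_)
    rw [integral_sub ((hF.push_iterate h.isMarkov t).integrable θ _) (integrable_const _)]
    simp
  · have := integral_mono (hi t).norm (integrable_const (b * (c * ρ ^ t)))
      fun y => h.norm_push_iterate_sub_le hF t θ y
    simpa using this

theorem norm_integral_push_iterate_sub_le (θ : T) (ν : Measure X) [IsProbabilityMeasure ν]
    (t : ℕ) : ‖∫ y, (push κ)^[t] F θ y ∂ν - ∫ y, F θ y ∂d θ‖ ≤ b * (c * ρ ^ t) := by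
  have e : ∫ y, (push κ)^[t] F θ y ∂ν - ∫ y, F θ y ∂d θ =
      ∫ y, ((push κ)^[t] F θ y - ∫ y, F θ y ∂d θ) ∂ν := by
    rw [integral_sub ((hF.push_iterate h.isMarkov t).integrable θ _) (integrable_const _)]
    simp
  rw [e]
  simpa using norm_integral_le_of_norm_le_const (μ := ν)
    (Eventually.of_forall (h.norm_push_iterate_sub_le hF t θ))

/-- One push shifts the series by one index, so only the term t = 0 survives in the difference. -/
theorem poisson_eq (θ : T) (x : X) :
    poisson κ d F θ x - push κ (poisson κ d F) θ x = F θ x - ∫ y, F θ y ∂d θ := by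
  have := h.isMarkov
  have h1 : push κ (poisson κ d F) θ x =
      ∑' t, ((push κ)^[t + 1] F θ x - ∫ y, F θ y ∂d θ) := by
    rw [push, h.integral_poisson hF]
    simp only [Function.iterate_succ_apply']
    rfl
  rw [h1, poisson, (h.summable_poisson hF θ x).tsum_eq_zero_add]
  simp

end IsErgodicFamily

section

variable (h : IsErgodicFamily κ d N c ρ) (hF : IsBddMeas F b) [CompleteSpace E]
  (hlip : ∃ L, ∀ (f : X → E) (b : ℝ), StronglyMeasurable f → (∀ x, ‖f x‖ ≤ b) → ∀ θ θ' x,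
      ‖∫ y, f y ∂κ (θ, x) - ∫ y, f y ∂κ (θ', x)‖ ≤ L * b * dist θ θ')
  (hU : IsUnifCont F)
include h hF hlip hU

theorem IsErgodicFamily.isUnifCont_push_iterate (t : ℕ) : IsUnifCont ((push κ)^[t] F) := by
  induction t with
  | zero => exact hU
  | succ t ih =>
    rw [Function.iterate_succ_apply']
    exact ih.push h.isMarkov hlip (hF.push_iterate h.isMarkov t)

/-- The mixing rate is uniform in θ and x, so the mean is a uniform limit of iterates; stationary
laws at different parameters are never compared directly. -/
theorem IsErgodicFamily.isUnifCont_mean :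
    IsUnifCont (fun θ (_ : X) => ∫ y, F θ y ∂d θ) := by
  refine IsUnifCont.of_approx fun ε hε => ?_
  obtain ⟨t, ht⟩ := ((h.summable_bound b).tendsto_atTop_zero.eventually (gt_mem_nhds hε)).exists
  refine ⟨_, h.isUnifCont_push_iterate hF hlip hU t, fun θ x => ?_⟩
  rw [norm_sub_rev]
  exact (h.norm_push_iterate_sub_le hF t θ x).trans ht.le

/-- The tails of the series are small uniformly in θ and x, and each partial sum is uniformly
continuous in θ. -/
theorem IsErgodicFamily.isUnifCont_poisson : IsUnifCont (poisson κ d F) := by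
  refine IsUnifCont.of_approx fun ε hε => ?_
  have h1 := tendsto_sum_nat_add (fun t => b * (c * ρ ^ t))
  obtain ⟨n, hn⟩ := (h1.eventually (gt_mem_nhds hε)).exists
  refine ⟨_, IsUnifCont.sum (fun t => (h.isUnifCont_push_iterate hF hlip hU t).add
    (h.isUnifCont_mean hF hlip hU).neg) n, fun θ x => ?_⟩
  simp only [← sub_eq_add_neg]
  rw [poisson, ← (h.summable_poisson hF θ x).sum_add_tsum_nat_add n, add_sub_cancel_left]
  refine (tsum_of_norm_bounded ((summable_nat_add_iff n).2 (h.summable_bound b)).hasSum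
    fun t => h.norm_push_iterate_sub_le hF (t + n) θ x).trans hn.le

end

end

end CACRL

namespace CACRL

/-! ### Closure properties of uniformly continuous bounded families -/

section

variable {T Y X E : Type*} [PseudoMetricSpace T] [MeasurableSpace T] [MeasurableSpace Y]
  [MeasurableSpace X] [NormedAddCommGroup E] [NormedSpace ℝ E]

omit [MeasurableSpace T] [MeasurableSpace Y] [NormedSpace ℝ E] in
theorem IsUnifCont.const (q : Y → E) : IsUnifCont (fun (_ : T) y => q y) :=
  fun ε hε => ⟨1, one_pos, fun θ θ' _ y => by simpa using hε.le⟩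

omit [PseudoMetricSpace T] [NormedSpace ℝ E] in
theorem IsBddMeas.const {q : Y → E} {b : ℝ} (hq : StronglyMeasurable q) (hb : ∀ y, ‖q y‖ ≤ b) :
    IsBddMeas (fun (_ : T) y => q y) b :=
  ⟨hq.comp_measurable measurable_snd, fun _ y => hb y⟩

omit [PseudoMetricSpace T] [NormedSpace ℝ E] in
theorem IsBddMeas.neg {F : T → Y → E} {b : ℝ} (hF : IsBddMeas F b) :
    IsBddMeas (fun θ y => - F θ y) b :=
  ⟨hF.meas.neg, fun θ y => by rw [norm_neg]; exact hF.le θ y⟩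

omit [MeasurableSpace T] [MeasurableSpace Y] in
theorem IsUnifCont.smul {f : T → Y → ℝ} {g : T → Y → E} {bf bg : ℝ} (hf : IsUnifCont f)
    (hg : IsUnifCont g) (hbf : ∀ θ y, ‖f θ y‖ ≤ bf) (hbg : ∀ θ y, ‖g θ y‖ ≤ bg) :
    IsUnifCont fun θ y => f θ y • g θ y := by
  intro ε hε
  obtain ⟨δ, hδ, h1⟩ := hf (ε / 2 / (|bg| + 1)) (by positivity)
  obtain ⟨δ', hδ', h2⟩ := hg (ε / 2 / (|bf| + 1)) (by positivity)
  refine ⟨min δ δ', lt_min hδ hδ', fun θ θ' hθ y => ?_⟩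
  have e : f θ y • g θ y - f θ' y • g θ' y =
      (f θ y - f θ' y) • g θ y + f θ' y • (g θ y - g θ' y) := by module
  rw [e]
  refine (norm_add_le _ _).trans ?_
  rw [norm_smul, norm_smul]
  have h3 := h1 θ θ' (hθ.trans_le (min_le_left _ _)) y
  have h4 := h2 θ θ' (hθ.trans_le (min_le_right _ _)) y
  have h5 : ‖g θ y‖ ≤ |bg| + 1 := (hbg θ y).trans ((le_abs_self _).trans (by linarith))
  have h6 : ‖f θ' y‖ ≤ |bf| + 1 := (hbf θ' y).trans ((le_abs_self _).trans (by linarith))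
  have h7 : ‖f θ y - f θ' y‖ * ‖g θ y‖ ≤ ε / 2 / (|bg| + 1) * (|bg| + 1) :=
    mul_le_mul h3 h5 (norm_nonneg _) (by positivity)
  have h8 : ‖f θ' y‖ * ‖g θ y - g θ' y‖ ≤ (|bf| + 1) * (ε / 2 / (|bf| + 1)) :=
    mul_le_mul h6 h4 (norm_nonneg _) (by positivity)
  rw [div_mul_cancel₀ _ (by positivity)] at h7
  rw [mul_div_cancel₀ _ (by positivity)] at h8
  linarith

omit [PseudoMetricSpace T] in
theorem IsBddMeas.smul {f : T → Y → ℝ} {g : T → Y → E} {bf bg : ℝ} (hf : IsBddMeas f bf)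
    (hg : IsBddMeas g bg) (hbf : 0 ≤ bf) : IsBddMeas (fun θ y => f θ y • g θ y) (bf * bg) :=
  ⟨hf.meas.smul hg.meas, fun θ y => by
    rw [norm_smul]; exact mul_le_mul (hf.le θ y) (hg.le θ y) (norm_nonneg _) hbf⟩

theorem IsUnifCont.integral_kernel {κ : Kernel Y X} [IsMarkovKernel κ] {F : T → X → E} {b : ℝ}
    (hU : IsUnifCont F) (hF : IsBddMeas F b) :
    IsUnifCont fun θ y => ∫ x, F θ x ∂κ y := by
  intro ε hε
  obtain ⟨δ, hδ, h1⟩ := hU ε hε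
  refine ⟨δ, hδ, fun θ θ' hθ y => ?_⟩
  rw [← integral_sub (hF.integrable θ _) (hF.integrable θ' _)]
  simpa using norm_integral_le_of_norm_le_const (μ := κ y) (Eventually.of_forall (h1 θ θ' hθ))

omit [PseudoMetricSpace T] in
theorem IsBddMeas.integral_kernel {κ : Kernel Y X} [IsMarkovKernel κ] {F : T → X → E} {b : ℝ}
    (hF : IsBddMeas F b) : IsBddMeas (fun θ y => ∫ x, F θ x ∂κ y) b := by
  refine ⟨?_, fun θ y => hF.norm_integral_le θ _⟩
  exact StronglyMeasurable.integral_kernel_prod_right (κ := κ.comap Prod.snd measurable_snd)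
    (f := fun (q : T × Y) x => F q.1 x)
    (hF.meas.comp_measurable (g := fun q : (T × Y) × X => (q.1.1, q.2)) (by fun_prop))

theorem IsUnifCont.integral_snd {ν : Measure X} [IsFiniteMeasure ν] {q : T → Y × X → E} {b : ℝ}
    (hU : IsUnifCont q) (hq : IsBddMeas q b) : IsUnifCont fun θ y => ∫ x, q θ (y, x) ∂ν := by
  intro ε hε
  obtain ⟨δ, hδ, h1⟩ := hU (ε / (ν.real univ + 1)) (by positivity)
  refine ⟨δ, hδ, fun θ θ' hθ y => ?_⟩
  have hi : ∀ θ, Integrable (fun x => q θ (y, x)) ν := fun θ =>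
    Integrable.of_bound ((hq.sm θ).comp_measurable measurable_prodMk_left).aestronglyMeasurable b
      (Eventually.of_forall fun x => hq.le θ _)
  rw [← integral_sub (hi θ) (hi θ')]
  refine (norm_integral_le_of_norm_le_const (μ := ν)
    (Eventually.of_forall fun x => h1 θ θ' hθ (y, x))).trans ?_
  rw [div_mul_eq_mul_div, div_le_iff₀ (by positivity)]
  exact mul_le_mul_of_nonneg_left (by linarith) hε.le

omit [PseudoMetricSpace T] in
theorem IsBddMeas.integral_snd {ν : Measure X} [IsFiniteMeasure ν] {q : T → Y × X → E} {b : ℝ}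
    (hq : IsBddMeas q b) : IsBddMeas (fun θ y => ∫ x, q θ (y, x) ∂ν) (b * ν.real univ) := by
  refine ⟨?_, fun θ y => norm_integral_le_of_norm_le_const
    (Eventually.of_forall fun x => hq.le θ _)⟩
  exact StronglyMeasurable.integral_prod_right (f := fun (p : T × Y) x => q p.1 (p.2, x))
    (hq.meas.comp_measurable (g := fun p : (T × Y) × X => (p.1.1, p.1.2, p.2)) (by fun_prop))

omit [NormedSpace ℝ E] in
-- Compactness of the parameter, state and action sets is converted here into bounds and moduli of
-- continuity that are uniform in (x, a).
theorem isUnifCont_isBddMeas_of_continuous {T Y : Type*} [PseudoMetricSpace T] [CompactSpace T]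
    [PseudoMetricSpace Y] [CompactSpace Y] [MeasurableSpace T] [MeasurableSpace Y]
    [OpensMeasurableSpace (T × Y)] [SecondCountableTopologyEither (T × Y) E]
    {q : T → Y → E} (hq : Continuous (Function.uncurry q)) :
    IsUnifCont q ∧ ∃ b, 0 ≤ b ∧ IsBddMeas q b := by
  constructor
  · intro ε hε
    have h1 := Metric.uniformContinuous_iff.1
      (CompactSpace.uniformContinuous_of_continuous hq) ε hε
    obtain ⟨δ, hδ, h2⟩ := h1
    refine ⟨δ, hδ, fun θ θ' hθ y => ?_⟩
    have := h2 (a := (θ, y)) (b := (θ', y)) (by simpa [Prod.dist_eq] using hθ)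
    rw [dist_eq_norm] at this
    exact this.le
  · obtain ⟨b, hb⟩ := isCompact_univ.exists_bound_of_continuousOn hq.continuousOn
    exact ⟨max b 0, le_max_right _ _, hq.stronglyMeasurable,
      fun θ y => (hb (θ, y) (mem_univ _)).trans (le_max_left _ _)⟩

end

/-! ### Kernels of the decision process, jointly in the policy parameter -/

attribute [instance] CMDP.isMarkov_trans CMDP.isMarkov_shift CMDP.isProb_init

variable {nS nZ nA K nθ : ℕ} {M : CMDP nS nZ nA K}

instance : IsMarkovKernel M.augTrans := by
  unfold CMDP.augTrans; infer_instance

namespace Policy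

variable (π : Policy M nθ) (Θ : Set (EuclideanSpace ℝ (Fin nθ)))

/-- The policy as a kernel, jointly in the parameter and the state. -/
noncomputable def polKernel : Kernel (Θ × M.X) M.A :=
  (Kernel.const _ π.ref).withDensity (fun q a => ENNReal.ofReal (π.dens q.1 q.2 a))

/-- The law of `(a_t, x_{t+1})` given `x_t`, jointly in the parameter and the state. -/
noncomputable def stepKernel : Kernel (Θ × M.X) (M.A × M.X) :=
  π.polKernel Θ ⊗ₖ M.augTrans.comap (fun q : (Θ × M.X) × M.A => (q.1.2, q.2)) (by fun_prop)

/-- The chain of augmented states, jointly in the parameter and the state. -/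
noncomputable def chainKernel : Kernel (Θ × M.X) M.X := (π.stepKernel Θ).snd

/-- The density `π_θ(a ∣ x)` as a family of functions of `(x, a)`. -/
def densAt (θ : Θ) (y : M.X × M.A) : ℝ := π.dens θ y.1 y.2

/-- The gradient `∇_θ π_θ(a ∣ x)` as a family of functions of `(x, a)`. -/
noncomputable def gradDens (θ : Θ) (y : M.X × M.A) : EuclideanSpace ℝ (Fin nθ) :=
  gradientWithin (fun θ' => π.dens θ' y.1 y.2) Θ θ

/-- The score as a family of functions of `(x, a)`. -/
noncomputable def scoreAt (θ : Θ) (y : M.X × M.A) : EuclideanSpace ℝ (Fin nθ) :=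
  π.score Θ θ y.1 y.2

end Policy

namespace ProblemAssumptions

variable {π : Policy M nθ} {Θ : Set (EuclideanSpace ℝ (Fin nθ))} (hM : ProblemAssumptions M π Θ)
include hM

theorem compactSpace_Θ : CompactSpace Θ := isCompact_iff_compactSpace.1 hM.isCompact_Θ

theorem compactSpace_XA : CompactSpace (M.X × M.A) := by
  have := isCompact_iff_compactSpace.1 hM.isCompact_S
  have := isCompact_iff_compactSpace.1 hM.isCompact_Z
  have := isCompact_iff_compactSpace.1 hM.isCompact_A
  infer_instance

theorem continuous_densAt : Continuous (Function.uncurry (π.densAt Θ)) :=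
  hM.policy_smooth.continuousOn.comp_continuous
    (f := fun q : Θ × M.X × M.A => ((q.1 : EuclideanSpace ℝ (Fin nθ)), q.2)) (by fun_prop)
    fun q => ⟨q.1.2, mem_univ _⟩

theorem continuous_gradDens : Continuous (Function.uncurry (π.gradDens Θ)) :=
  hM.policy_smooth.continuousOn_gradient.comp_continuous
    (f := fun q : Θ × M.X × M.A => ((q.1 : EuclideanSpace ℝ (Fin nθ)), q.2)) (by fun_prop)
    fun q => ⟨q.1.2, mem_univ _⟩

theorem uniqueDiffOn : UniqueDiffOn ℝ Θ := uniqueDiffOn_convex hM.convex_Θ hM.interior_Θ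

theorem hasGradientWithinAt_dens (θ : Θ) (y : M.X × M.A) :
    HasGradientWithinAt (fun θ' => π.dens θ' y.1 y.2) (π.gradDens Θ θ y) Θ θ :=
  (hM.policy_smooth.differentiableOn y.1 y.2 θ θ.2).hasGradientWithinAt

/-- The logarithmic derivative. Gradients within Θ are unique because Θ is convex with nonempty
interior. -/
theorem scoreAt_eq (θ : Θ) (y : M.X × M.A) :
    π.scoreAt Θ θ y = (π.densAt Θ θ y)⁻¹ • π.gradDens Θ θ y := by
  have h1 := (hM.hasGradientWithinAt_dens θ y).hasFDerivWithinAt.log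
    (hM.policy_smooth.pos θ θ.2 y.1 y.2).ne'
  have h2 : HasGradientWithinAt (fun θ' => Real.log (π.dens θ' y.1 y.2))
      ((π.densAt Θ θ y)⁻¹ • π.gradDens Θ θ y) Θ θ := by
    rw [hasGradientWithinAt_iff_hasFDerivWithinAt, map_smul]
    exact h1
  have h3 := h2.differentiableWithinAt.hasGradientWithinAt
  have h4 := (hM.uniqueDiffOn θ θ.2).eq h3.hasFDerivWithinAt h2.hasFDerivWithinAt
  exact (InnerProductSpace.toDual ℝ _).injective h4

theorem densAt_pos (θ : Θ) (y : M.X × M.A) : 0 < π.densAt Θ θ y :=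
  hM.policy_smooth.pos θ θ.2 y.1 y.2

/-- The likelihood-ratio identity: policy averages of scores become reference integrals of density
gradients. -/
theorem densAt_smul_scoreAt (θ : Θ) (y : M.X × M.A) :
    π.densAt Θ θ y • π.scoreAt Θ θ y = π.gradDens Θ θ y := by
  rw [hM.scoreAt_eq, smul_smul, mul_inv_cancel₀ (hM.densAt_pos θ y).ne', one_smul]

theorem continuous_scoreAt : Continuous (Function.uncurry (π.scoreAt Θ)) := by
  have : Function.uncurry (π.scoreAt Θ) = fun q =>
      (Function.uncurry (π.densAt Θ) q)⁻¹ • Function.uncurry (π.gradDens Θ) q := by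
    ext1 q; exact hM.scoreAt_eq q.1 q.2
  rw [this]
  exact (hM.continuous_densAt.inv₀ fun q => (hM.densAt_pos q.1 q.2).ne').smul
    hM.continuous_gradDens

theorem dens_prop : IsUnifCont (π.densAt Θ) ∧ ∃ b, 0 ≤ b ∧ IsBddMeas (π.densAt Θ) b := by
  have := hM.compactSpace_Θ
  have := hM.compactSpace_XA
  exact isUnifCont_isBddMeas_of_continuous hM.continuous_densAt

theorem gradDens_prop : IsUnifCont (π.gradDens Θ) ∧ ∃ b, 0 ≤ b ∧ IsBddMeas (π.gradDens Θ) b := by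
  have := hM.compactSpace_Θ
  have := hM.compactSpace_XA
  exact isUnifCont_isBddMeas_of_continuous hM.continuous_gradDens

theorem scoreAt_prop : IsUnifCont (π.scoreAt Θ) ∧ ∃ b, 0 ≤ b ∧ IsBddMeas (π.scoreAt Θ) b := by
  have := hM.compactSpace_Θ
  have := hM.compactSpace_XA
  exact isUnifCont_isBddMeas_of_continuous hM.continuous_scoreAt

theorem measurable_dens_uncurry :
    Measurable (Function.uncurry fun (q : Θ × M.X) a => ENNReal.ofReal (π.dens q.1 q.2 a)) := by
  obtain ⟨-, b, -, hb⟩ := hM.dens_prop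
  exact (hb.meas.measurable.comp (g := Function.uncurry (π.densAt Θ))
    (f := fun q : (Θ × M.X) × M.A => (q.1.1, q.1.2, q.2)) (by fun_prop)).ennreal_ofReal

theorem polKernel_apply (θ : Θ) (x : M.X) :
    π.polKernel Θ (θ, x) = π.ref.withDensity fun a => ENNReal.ofReal (π.dens θ x a) := by
  rw [Policy.polKernel, Kernel.withDensity_apply _ hM.measurable_dens_uncurry, Kernel.const_apply]

theorem kernel_apply (θ : Θ) (x : M.X) : π.kernel θ x = π.polKernel Θ (θ, x) := by
  rw [hM.polKernel_apply, Policy.kernel, Kernel.withDensity_apply, Kernel.const_apply]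
  exact hM.measurable_dens_uncurry.comp
    (f := fun q : M.X × M.A => ((θ, q.1), q.2)) (by fun_prop)

theorem integrable_dens (θ : Θ) (x : M.X) : Integrable (fun a => π.dens θ x a) π.ref := by
  obtain ⟨-, b, -, hb⟩ := hM.dens_prop
  exact Integrable.of_bound
    ((hb.sm θ).comp_measurable (measurable_prodMk_left (x := x))).aestronglyMeasurable b
    (Eventually.of_forall fun a => hb.le θ (x, a))

theorem integrable_densAt (θ : Θ) (x : M.X) :
    Integrable (fun a => π.densAt Θ θ (x, a)) π.ref := hM.integrable_dens θ x

theorem isMarkovKernel_polKernel : IsMarkovKernel (π.polKernel Θ) := by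
  refine ⟨fun q => ⟨?_⟩⟩
  rw [hM.polKernel_apply, withDensity_apply _ .univ, Measure.restrict_univ,
    ← ofReal_integral_eq_lintegral_ofReal (hM.integrable_dens _ _)
      (Eventually.of_forall fun a => (hM.densAt_pos q.1 (q.2, a)).le),
    hM.policy_smooth.normalized q.1 q.1.2 q.2, ENNReal.ofReal_one]

theorem isMarkovKernel_stepKernel : IsMarkovKernel (π.stepKernel Θ) := by
  have := hM.isMarkovKernel_polKernel
  unfold Policy.stepKernel
  infer_instance

theorem isMarkovKernel_chainKernel : IsMarkovKernel (π.chainKernel Θ) := by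
  have := hM.isMarkovKernel_stepKernel
  unfold Policy.chainKernel
  infer_instance

theorem kernel_eq (θ : Θ) : π.kernel θ = (π.polKernel Θ).sectR θ := by
  ext1 x; exact hM.kernel_apply θ x

/-- In a run the parameter is random, so conditioning requires a kernel measurable jointly in (θ,
x). Freezing θ gives back the original step. -/
theorem step_apply (θ : Θ) (x : M.X) : π.step θ x = π.stepKernel Θ (θ, x) := by
  have := hM.isMarkovKernel_polKernel
  rw [Policy.step, Policy.stepKernel, hM.kernel_eq]
  ext s hs
  rw [Kernel.compProd_apply hs, Kernel.compProd_apply hs]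
  rfl

theorem chain_eq (θ : Θ) : π.chain θ = (π.chainKernel Θ).sectR θ := by
  ext1 x
  rw [Policy.chain, Kernel.sectR_apply, Policy.chainKernel, Kernel.snd_apply, Kernel.snd_apply,
    hM.step_apply]

variable {E : Type*} [NormedAddCommGroup E] [NormedSpace ℝ E]

theorem integral_polKernel (θ : Θ) (x : M.X) (f : M.A → E) :
    ∫ a, f a ∂π.polKernel Θ (θ, x) = ∫ a, π.densAt Θ θ (x, a) • f a ∂π.ref := by
  rw [hM.polKernel_apply, integral_withDensity_eq_integral_toReal_smul]
  · refine integral_congr_ae (Eventually.of_forall fun a => ?_)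
    simp only
    rw [ENNReal.toReal_ofReal (hM.policy_smooth.pos θ θ.2 x a).le]
    rfl
  · exact hM.measurable_dens_uncurry.comp (measurable_prodMk_left (x := (θ, x)))
  · exact Eventually.of_forall fun a => ENNReal.ofReal_lt_top

theorem integral_stepKernel (θ : Θ) (x : M.X) {f : M.A × M.X → E} (hf : StronglyMeasurable f)
    {b : ℝ} (hb : ∀ p, ‖f p‖ ≤ b) :
    ∫ p, f p ∂π.stepKernel Θ (θ, x) =
      ∫ a, π.densAt Θ θ (x, a) • ∫ x', f (a, x') ∂M.augTrans (x, a) ∂π.ref := by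
  have := hM.isMarkovKernel_polKernel
  rw [← hM.integral_polKernel, Policy.stepKernel, integral_compProd]
  · rfl
  · exact Integrable.of_bound hf.aestronglyMeasurable b (Eventually.of_forall hb)

theorem integral_stepKernel_fst [CompleteSpace E] (θ : Θ) (x : M.X) {f : M.A → E}
    (hf : StronglyMeasurable f) {b : ℝ} (hb : ∀ a, ‖f a‖ ≤ b) :
    ∫ p, f p.1 ∂π.stepKernel Θ (θ, x) = ∫ a, π.densAt Θ θ (x, a) • f a ∂π.ref := by
  rw [hM.integral_stepKernel θ x (f := fun p => f p.1) (hf.comp_measurable measurable_fst)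
    fun p => hb p.1]
  simp only [integral_const, probReal_univ, one_smul]

theorem integral_chainKernel (θ : Θ) (x : M.X) {f : M.X → E} (hf : StronglyMeasurable f)
    {b : ℝ} (hb : ∀ p, ‖f p‖ ≤ b) :
    ∫ y, f y ∂π.chainKernel Θ (θ, x) =
      ∫ a, π.densAt Θ θ (x, a) • ∫ x', f x' ∂M.augTrans (x, a) ∂π.ref := by
  rw [Policy.chainKernel, Kernel.snd_apply, integral_map measurable_snd.aemeasurable
    hf.aestronglyMeasurable,
    hM.integral_stepKernel θ x (f := fun p => f p.2) (hf.comp_measurable measurable_snd)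
      fun p => hb p.2]

/-- The parameter enters only through the policy density; its Lipschitz constant times the reference
mass controls the integral of every bounded function. -/
theorem chainKernel_lipschitz : ∃ L, ∀ (f : M.X → E) (b : ℝ), StronglyMeasurable f →
    (∀ x, ‖f x‖ ≤ b) → ∀ (θ θ' : Θ) x,
      ‖∫ y, f y ∂π.chainKernel Θ (θ, x) - ∫ y, f y ∂π.chainKernel Θ (θ', x)‖
        ≤ L * b * dist θ θ' := by
  obtain ⟨L, hL⟩ := hM.policy_lipschitz
  obtain ⟨-, bd, hbd0, hbd⟩ := hM.dens_prop
  refine ⟨L * π.ref.real univ, fun f b hf hb θ θ' x => ?_⟩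
  rw [hM.integral_chainKernel θ x hf hb, hM.integral_chainKernel θ' x hf hb]
  have hg : IsBddMeas (fun (_ : Θ) y => ∫ x', f x' ∂M.augTrans y) b :=
    (IsBddMeas.const hf hb).integral_kernel
  have hi : ∀ θ : Θ, Integrable
      (fun a => π.densAt Θ θ (x, a) • ∫ x', f x' ∂M.augTrans (x, a)) π.ref := fun θ =>
    Integrable.of_bound (((hbd.smul hg hbd0).sm θ).comp_measurable
      (measurable_prodMk_left (x := x))).aestronglyMeasurable (bd * b)
      (Eventually.of_forall fun a => (hbd.smul hg hbd0).le θ (x, a))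
  rw [← integral_sub (hi θ) (hi θ')]
  have h1 : ∀ a, ‖π.densAt Θ θ (x, a) • ∫ x', f x' ∂M.augTrans (x, a) -
      π.densAt Θ θ' (x, a) • ∫ x', f x' ∂M.augTrans (x, a)‖ ≤ L * dist θ θ' * b := fun a => by
    rw [← sub_smul, norm_smul]
    refine mul_le_mul ?_ (hg.le θ (x, a)) (norm_nonneg _) (by positivity)
    rw [← dist_eq_norm]
    exact (hL x a).dist_le_mul θ θ.2 θ' θ'.2
  refine (norm_integral_le_of_norm_le_const (Eventually.of_forall h1)).trans (le_of_eq ?_)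
  ring

theorem exists_isErgodicFamily : ∃ d c ρ,
    IsErgodicFamily (π.chainKernel Θ) d (fun θ t => π.nStep θ t) c ρ := by
  obtain ⟨c, hc, ρ, hρ, hρ1, h⟩ := hM.ergodic
  choose d hd hinv htv using fun θ : Θ => h θ θ.2
  refine ⟨d, c, ρ, hM.isMarkovKernel_chainKernel, hd, fun θ t => ?_, fun θ => ?_, fun θ => rfl,
    fun θ t => ?_, htv, hc.le, hρ.le, hρ1⟩
  · have := hM.isMarkovKernel_chainKernel
    induction t with
    | zero => rw [Policy.nStep]; infer_instance
    | succ t ih => rw [Policy.nStep, hM.chain_eq]; infer_instance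
  · rw [← hM.chain_eq]; exact hinv θ
  · rw [Policy.nStep, hM.chain_eq]

end ProblemAssumptions

end CACRL

/-! ### Average costs and value functions -/

namespace CACRL

variable {nS nZ nA K nθ : ℕ} {M : CMDP nS nZ nA K}

theorem CMDP.measurable_shapedCost (M : CMDP nS nZ nA K) (k : Fin (K + 1)) :
    Measurable fun q : (M.X × M.A) × M.X => M.shapedCost k q.1.1 q.1.2 q.2 := by
  have h1 : Measurable fun q : (M.X × M.A) × M.X => M.cost k q.1.1.1 q.1.2 :=
    (M.measurable_cost k).comp (f := fun q : (M.X × M.A) × M.X => (q.1.1.1, q.1.2)) (by fun_prop)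
  have h2 : Measurable fun q : (M.X × M.A) × M.X => M.pot k q.2 :=
    (M.measurable_pot k).comp measurable_snd
  have h3 : Measurable fun q : (M.X × M.A) × M.X => M.pot k q.1.1 :=
    (M.measurable_pot k).comp (measurable_fst.comp measurable_fst)
  exact h1.add (h2.sub h3)

/-- The expected reshaped cost given the current state and action. -/
noncomputable def CMDP.expCost (M : CMDP nS nZ nA K) (k : Fin (K + 1)) (y : M.X × M.A) : ℝ :=
  ∫ x', M.shapedCost k y.1 y.2 x' ∂M.augTrans y

theorem CMDP.stronglyMeasurable_expCost (M : CMDP nS nZ nA K) (k : Fin (K + 1)) :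
    StronglyMeasurable (M.expCost k) :=
  (M.measurable_shapedCost k).stronglyMeasurable.integral_kernel_prod_right' (κ := M.augTrans)

namespace Policy

variable (π : Policy M nθ) (Θ : Set (EuclideanSpace ℝ (Fin nθ)))

/-- `meanCost` as a family over `Θ`. -/
noncomputable def meanAt (k : Fin (K + 1)) (θ : Θ) (x : M.X) : ℝ := π.meanCost k θ x

/-- The relative value function of the average-cost problem. -/
noncomputable def relValue (d : Θ → Measure M.X) (k : Fin (K + 1)) : Θ → M.X → ℝ :=
  poisson (π.chainKernel Θ) d (π.meanAt Θ k)

/-- The state-action value function in terms of the relative value function. -/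
noncomputable def valueAt (d : Θ → Measure M.X) (k : Fin (K + 1)) (θ : Θ) (y : M.X × M.A) : ℝ :=
  M.expCost k y + -(∫ x, π.meanAt Θ k θ x ∂d θ) + ∫ x', π.relValue Θ d k θ x' ∂M.augTrans y

end Policy

namespace ProblemAssumptions

variable {π : Policy M nθ} {Θ : Set (EuclideanSpace ℝ (Fin nθ))} (hM : ProblemAssumptions M π Θ)
  {b : ℝ}

theorem abs_expCost_le (hb : ∀ k x a x', |M.shapedCost k x a x'| ≤ b) (k : Fin (K + 1))
    (y : M.X × M.A) : ‖M.expCost k y‖ ≤ b := by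
  rw [CMDP.expCost]
  simpa using norm_integral_le_of_norm_le_const (μ := M.augTrans y)
    (f := fun x' => M.shapedCost k y.1 y.2 x') (C := b) (Eventually.of_forall fun x' => hb k y.1 y.2 x')

include hM

theorem meanAt_eq (hb : ∀ k x a x', |M.shapedCost k x a x'| ≤ b) (k : Fin (K + 1)) (θ : Θ)
    (x : M.X) :
    π.meanAt Θ k θ x = ∫ a, π.densAt Θ θ (x, a) • M.expCost k (x, a) ∂π.ref := by
  rw [Policy.meanAt, Policy.meanCost, hM.step_apply,
    hM.integral_stepKernel θ x (f := fun p => M.shapedCost k x p.1 p.2)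
    ((M.measurable_shapedCost k).comp (f := fun p : M.A × M.X => ((x, p.1), p.2))
      (by fun_prop)).stronglyMeasurable fun p => hb k x p.1 p.2]
  rfl

theorem isUnifCont_meanAt (hb : ∀ k x a x', |M.shapedCost k x a x'| ≤ b) (k : Fin (K + 1)) :
    IsUnifCont (π.meanAt Θ k) := by
  obtain ⟨hU, bd, hbd0, hbd⟩ := hM.dens_prop
  have e : π.meanAt Θ k = fun θ x => ∫ a, π.densAt Θ θ (x, a) • M.expCost k (x, a) ∂π.ref := by
    ext θ x; exact hM.meanAt_eq hb k θ x
  rw [e]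
  have hc : IsBddMeas (fun (_ : Θ) y => M.expCost k y) b :=
    IsBddMeas.const (M.stronglyMeasurable_expCost k) (abs_expCost_le hb k)
  exact IsUnifCont.integral_snd (hU.smul (IsUnifCont.const _) hbd.le hc.le) (hbd.smul hc hbd0)

theorem isBddMeas_meanAt (hb : ∀ k x a x', |M.shapedCost k x a x'| ≤ b) (k : Fin (K + 1)) :
    IsBddMeas (π.meanAt Θ k) b := by
  obtain ⟨hU, bd, hbd0, hbd⟩ := hM.dens_prop
  have := hM.isMarkovKernel_stepKernel
  have hc : IsBddMeas (fun (_ : Θ) y => M.expCost k y) b :=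
    IsBddMeas.const (M.stronglyMeasurable_expCost k) (abs_expCost_le hb k)
  constructor
  · have e : π.meanAt Θ k = fun θ x => ∫ a, π.densAt Θ θ (x, a) • M.expCost k (x, a) ∂π.ref := by
      ext θ x; exact hM.meanAt_eq hb k θ x
    rw [e]
    exact (IsBddMeas.integral_snd (hbd.smul hc hbd0)).meas
  -- Integrating the cost against the Markov kernel gives the bound b itself; the density formula
  -- would also bring in the bounds on the density and the reference mass.
  · intro θ x
    rw [Policy.meanAt, Policy.meanCost, hM.step_apply]
    simpa using norm_integral_le_of_norm_le_const (μ := π.stepKernel Θ (θ, x))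
      (f := fun p => M.shapedCost k x p.1 p.2) (C := b) (Eventually.of_forall fun p => hb k x p.1 p.2)

variable {d : Θ → Measure M.X} {c ρ : ℝ}
  (h : IsErgodicFamily (π.chainKernel Θ) d (fun θ t => π.nStep θ t) c ρ)
  (hb : ∀ k x a x', |M.shapedCost k x a x'| ≤ b)
include h hb

/-- The expected cost at time t converges geometrically to the stationary mean whatever the initial
law, and Cesàro averaging keeps the limit. -/
theorem tendsto_avgCost (k : Fin (K + 1)) (θ : Θ) :
    Tendsto (π.avgCost k θ) atTop (𝓝 (∫ x, π.meanAt Θ k θ x ∂d θ)) := by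
  have hF := hM.isBddMeas_meanAt hb k
  refine Tendsto.cesaro ?_
  rw [tendsto_iff_norm_sub_tendsto_zero]
  refine squeeze_zero (fun t => norm_nonneg _) (fun t => ?_)
    (h.summable_bound b).tendsto_atTop_zero
  have := h.norm_integral_push_iterate_sub_le hF θ M.init t
  simp_rw [h.push_iterate_eq hF] at this
  exact this

theorem fdot_eq (k : Fin (K + 1)) (θ : Θ) :
    π.fdot k θ = ∫ x, π.meanAt Θ k θ x ∂d θ :=
  (hM.tendsto_avgCost h hb k θ).limUnder_eq

theorem costAt_succ_eq (k : Fin (K + 1)) (θ : Θ) (x : M.X) (a : M.A) (l : ℕ) :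
    π.costAt k θ x a (l + 1) =
      ∫ x', (push (π.chainKernel Θ))^[l] (π.meanAt Θ k) θ x' ∂M.augTrans (x, a) := by
  simp_rw [h.push_iterate_eq (hM.isBddMeas_meanAt hb k)]
  rfl

/-- The terms of the series of `Q` are dominated by a summable sequence. -/
theorem exists_bound_costAt : ∃ β : ℕ → ℝ, Summable β ∧ ∀ (k : Fin (K + 1)) (θ : Θ) x a l,
    ‖π.costAt k θ x a l - π.fdot k θ‖ ≤ β l := by
  -- The cost at time 0 has its action prescribed, so mixing says nothing about it. For l ≥ 1, the
  -- law of the first successor state has undergone l - 1 chain steps.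
  refine ⟨fun l => if l = 0 then b + b else b * (c * ρ ^ (l - 1)), ?_, fun k θ x a l => ?_⟩
  · rw [← summable_nat_add_iff 1]
    simpa using h.summable_bound b
  have := h.isProb θ
  have hF := hM.isBddMeas_meanAt hb k
  rw [hM.fdot_eq h hb]
  cases l with
  | zero =>
    exact (norm_sub_le _ _).trans (add_le_add (abs_expCost_le hb k (x, a))
      (hF.norm_integral_le θ _))
  | succ l =>
    rw [hM.costAt_succ_eq h hb]
    simpa using h.norm_integral_push_iterate_sub_le hF θ (M.augTrans (x, a)) l

theorem summable_costAt (k : Fin (K + 1)) (θ : Θ) (x : M.X) (a : M.A) :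
    Summable fun l => π.costAt k θ x a l - π.fdot k θ := by
  obtain ⟨β, hβ, h1⟩ := hM.exists_bound_costAt h hb
  exact Summable.of_norm_bounded hβ (h1 k θ x a)

/-- The Bellman form of Q: the term at time 0 is split off, and the rest is the Poisson series
integrated over the next state. -/
theorem Q_eq (k : Fin (K + 1)) (θ : Θ) (x : M.X) (a : M.A) :
    π.Q k θ x a = π.valueAt Θ d k θ (x, a) := by
  rw [Policy.Q, (hM.summable_costAt h hb k θ x a).tsum_eq_zero_add, Policy.valueAt,
    Policy.relValue, h.integral_poisson (hM.isBddMeas_meanAt hb k)]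
  simp_rw [hM.costAt_succ_eq h hb, hM.fdot_eq h hb]
  rfl

/-- Truncation of the series of `Q` is uniformly accurate. -/
theorem exists_truncation_bound : ∃ τ : ℕ → ℝ, Tendsto τ atTop (𝓝 0) ∧
    ∀ (k : Fin (K + 1)) (θ : Θ) (x : M.X) (a : M.A) (T : ℕ),
      ‖π.Q k θ x a - π.Qhat k θ (π.fdot k θ) T x a‖ ≤ τ T := by
  obtain ⟨β, hβ, h1⟩ := hM.exists_bound_costAt h hb
  refine ⟨fun T => ∑' l, β (l + T), tendsto_sum_nat_add β, fun k θ x a T => ?_⟩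
  rw [Policy.Q, Policy.Qhat, ← (hM.summable_costAt h hb k θ x a).sum_add_tsum_nat_add T,
    add_sub_cancel_left]
  exact tsum_of_norm_bounded ((summable_nat_add_iff T).2 hβ).hasSum fun l => h1 k θ x a (l + T)

theorem relValue_prop (k : Fin (K + 1)) : IsUnifCont (π.relValue Θ d k) ∧
    ∃ b', 0 ≤ b' ∧ IsBddMeas (π.relValue Θ d k) b' := by
  have hF := hM.isBddMeas_meanAt hb k
  refine ⟨h.isUnifCont_poisson hF hM.chainKernel_lipschitz (hM.isUnifCont_meanAt hb k),
    |∑' t, b * (c * ρ ^ t)|, abs_nonneg _, ?_⟩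
  exact ⟨(h.isBddMeas_poisson hF).meas,
    fun θ x => ((h.isBddMeas_poisson hF).le θ x).trans (le_abs_self _)⟩

theorem valueAt_prop (k : Fin (K + 1)) : IsUnifCont (π.valueAt Θ d k) ∧
    ∃ b', 0 ≤ b' ∧ IsBddMeas (π.valueAt Θ d k) b' := by
  obtain ⟨hU, b', hb'0, hb'⟩ := hM.relValue_prop h hb k
  have hF := hM.isBddMeas_meanAt hb k
  have hc : IsBddMeas (fun (_ : Θ) y => M.expCost k y) b :=
    IsBddMeas.const (M.stronglyMeasurable_expCost k) (abs_expCost_le hb k)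
  have hm : IsBddMeas (fun (θ : Θ) (_ : M.X × M.A) => ∫ x, π.meanAt Θ k θ x ∂d θ) b :=
    ⟨(h.stronglyMeasurable_mean hF).comp_measurable measurable_fst, fun θ _ => by
      have := h.isProb θ
      exact hF.norm_integral_le θ _⟩
  have hUm : IsUnifCont (fun (θ : Θ) (_ : M.X × M.A) => ∫ x, π.meanAt Θ k θ x ∂d θ) := by
    intro ε hε
    obtain ⟨δ, hδ, h1⟩ := h.isUnifCont_mean hF hM.chainKernel_lipschitz
      (hM.isUnifCont_meanAt hb k) ε hε
    exact ⟨δ, hδ, fun θ θ' hθ y => h1 θ θ' hθ y.1⟩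
  have hB := (hc.add hm.neg).add (hb'.integral_kernel (κ := M.augTrans))
  refine ⟨((IsUnifCont.const _).add hUm.neg).add (hU.integral_kernel hb'), _, abs_nonneg _,
    hB.meas, fun θ x => (hB.le θ x).trans (le_abs_self _)⟩

end ProblemAssumptions

end CACRL

namespace CACRL

/-! ### The policy gradient -/

theorem hasGradientWithinAt_of_forall {F : Type*} [NormedAddCommGroup F] [InnerProductSpace ℝ F]
    [CompleteSpace F] {f : F → ℝ} {G : F} {s : Set F} {x : F}
    (h : ∀ ε > 0, ∃ δ > 0, ∀ y ∈ s, dist x y < δ →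
      |f y - f x - inner ℝ (y - x) G| ≤ ε * dist x y) : HasGradientWithinAt f G s x := by
  rw [hasGradientWithinAt_iff_hasFDerivWithinAt, hasFDerivWithinAt_iff_isLittleO,
    Asymptotics.isLittleO_iff]
  intro ε hε
  obtain ⟨δ, hδ, h1⟩ := h ε hε
  filter_upwards [self_mem_nhdsWithin, mem_nhdsWithin_of_mem_nhds (Metric.ball_mem_nhds x hδ)]
    with y hy hyδ
  have := h1 y hy (by rwa [dist_comm])
  rw [dist_comm, dist_eq_norm, real_inner_comm] at this
  simpa using this

variable {nS nZ nA K nθ : ℕ} {M : CMDP nS nZ nA K}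

namespace Policy

variable (π : Policy M nθ) (Θ : Set (EuclideanSpace ℝ (Fin nθ)))

/-- `∫ Q(x, a) ∇_θ π_θ(a ∣ x) da`. -/
noncomputable def localGrad (d : Θ → Measure M.X) (k : Fin (K + 1)) (θ : Θ) (x : M.X) :
    EuclideanSpace ℝ (Fin nθ) :=
  ∫ a, π.valueAt Θ d k θ (x, a) • π.gradDens Θ θ (x, a) ∂π.ref

end Policy

namespace ProblemAssumptions

variable {π : Policy M nθ} {Θ : Set (EuclideanSpace ℝ (Fin nθ))} (hM : ProblemAssumptions M π Θ)
include hM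

/-- First-order expansion of the densities, uniformly in state and action. -/
theorem dens_taylor : ∀ ε > 0, ∃ δ > 0, ∀ θ θ' : Θ, dist θ θ' < δ → ∀ y,
    |π.densAt Θ θ' y - π.densAt Θ θ y - inner ℝ ((θ' : EuclideanSpace ℝ (Fin nθ)) - θ) (π.gradDens Θ θ y)|
      ≤ ε * dist θ θ' := by
  intro ε hε
  obtain ⟨δ, hδ, h1⟩ := hM.gradDens_prop.1 ε hε
  refine ⟨δ, hδ, fun θ θ' hθ y => ?_⟩
  -- On this convex set the gradient stays within ε of its value at θ, so the mean value inequality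
  -- gives the expansion with a δ independent of y.
  have hconv : Convex ℝ (Θ ∩ Metric.ball (θ : EuclideanSpace ℝ (Fin nθ)) δ) :=
    hM.convex_Θ.inter (convex_ball _ _)
  have h2 := hconv.norm_image_sub_le_of_norm_hasFDerivWithin_le'
    (f := fun ξ => π.dens ξ y.1 y.2)
    (f' := fun ξ => InnerProductSpace.toDual ℝ _
      (gradientWithin (fun θ' => π.dens θ' y.1 y.2) Θ ξ))
    (φ := InnerProductSpace.toDual ℝ _ (π.gradDens Θ θ y)) (C := ε)
    (x := (θ : EuclideanSpace ℝ (Fin nθ))) (y := (θ' : EuclideanSpace ℝ (Fin nθ)))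
    (fun ξ hξ => ((hM.hasGradientWithinAt_dens ⟨ξ, hξ.1⟩ y).hasFDerivWithinAt).mono
      inter_subset_left)
    (fun ξ hξ => by
      rw [← map_sub, LinearIsometryEquiv.norm_map, norm_sub_rev]
      exact h1 θ ⟨ξ, hξ.1⟩ (by rw [dist_comm]; exact hξ.2) y)
    ⟨θ.2, Metric.mem_ball_self hδ⟩ ⟨θ'.2, by rw [dist_comm] at hθ; exact hθ⟩
  rw [InnerProductSpace.toDual_apply_apply, real_inner_comm, Real.norm_eq_abs, norm_sub_rev,
    ← dist_eq_norm] at h2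
  exact h2

theorem integrable_gradDens (θ : Θ) (x : M.X) :
    Integrable (fun a => π.gradDens Θ θ (x, a)) π.ref := by
  obtain ⟨-, b, -, hb⟩ := hM.gradDens_prop
  exact Integrable.of_bound
    ((hb.sm θ).comp_measurable (measurable_prodMk_left (x := x))).aestronglyMeasurable b
    (Eventually.of_forall fun a => hb.le θ (x, a))

theorem integral_densAt (θ : Θ) (x : M.X) : ∫ a, π.densAt Θ θ (x, a) ∂π.ref = 1 :=
  hM.policy_smooth.normalized θ θ.2 x

/-- The gradients of the densities integrate to zero. -/
theorem integral_gradDens (θ : Θ) (x : M.X) : ∫ a, π.gradDens Θ θ (x, a) ∂π.ref = 0 := by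
  -- Normalization is differentiated under the integral: the constant 1 has this gradient by the
  -- uniform expansion, and 0 as well, so the two agree.
  have h1 : HasGradientWithinAt (fun _ : EuclideanSpace ℝ (Fin nθ) => (1 : ℝ))
      (∫ a, π.gradDens Θ θ (x, a) ∂π.ref) Θ θ := by
    refine hasGradientWithinAt_of_forall fun ε hε => ?_
    obtain ⟨δ, hδ, h1⟩ := hM.dens_taylor (ε / (π.ref.real univ + 1)) (by positivity)
    refine ⟨δ, hδ, fun θ' hθ' hd => ?_⟩
    have h2 := norm_integral_le_of_norm_le_const (μ := π.ref)
      (f := fun a => π.densAt Θ ⟨θ', hθ'⟩ (x, a) - π.densAt Θ θ (x, a) -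
        inner ℝ (θ' - (θ : EuclideanSpace ℝ (Fin nθ))) (π.gradDens Θ θ (x, a)))
      (Eventually.of_forall fun a => h1 θ ⟨θ', hθ'⟩ hd (x, a))
    have i1 := hM.integrable_densAt θ x
    have i2 := hM.integrable_densAt ⟨θ', hθ'⟩ x
    have i3 := (hM.integrable_gradDens θ x).const_inner (𝕜 := ℝ) (θ' - (θ : EuclideanSpace ℝ (Fin nθ)))
    have e : ∫ a, (π.densAt Θ ⟨θ', hθ'⟩ (x, a) - π.densAt Θ θ (x, a) -
        inner ℝ (θ' - (θ : EuclideanSpace ℝ (Fin nθ))) (π.gradDens Θ θ (x, a))) ∂π.ref =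
        1 - 1 - inner ℝ (θ' - (θ : EuclideanSpace ℝ (Fin nθ))) (∫ a, π.gradDens Θ θ (x, a) ∂π.ref) := by
      have i12 : Integrable (fun a => π.densAt Θ ⟨θ', hθ'⟩ (x, a) - π.densAt Θ θ (x, a)) π.ref :=
        i2.sub i1
      rw [integral_sub i12 i3, integral_sub i2 i1, hM.integral_densAt, hM.integral_densAt,
        integral_inner (hM.integrable_gradDens θ x)]
    rw [Real.norm_eq_abs, e] at h2
    have hdist : dist θ ⟨θ', hθ'⟩ = dist (θ : EuclideanSpace ℝ (Fin nθ)) θ' := rfl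
    rw [hdist] at h2
    refine h2.trans ?_
    have e2 : ε / (π.ref.real univ + 1) * dist (θ : EuclideanSpace ℝ (Fin nθ)) θ' *
        π.ref.real univ = (ε * dist (θ : EuclideanSpace ℝ (Fin nθ)) θ') *
          (π.ref.real univ / (π.ref.real univ + 1)) := by ring
    rw [e2]
    refine mul_le_of_le_one_right (by positivity) ?_
    rw [div_le_one (by positivity)]
    linarith
  have h2 : HasGradientWithinAt (fun _ : EuclideanSpace ℝ (Fin nθ) => (1 : ℝ)) 0 Θ θ := by
    rw [hasGradientWithinAt_iff_hasFDerivWithinAt, map_zero]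
    exact hasFDerivWithinAt_const _ _ _
  exact (InnerProductSpace.toDual ℝ _).injective
    ((hM.uniqueDiffOn θ θ.2).eq h1.hasFDerivWithinAt h2.hasFDerivWithinAt)

variable {d : Θ → Measure M.X} {c ρ b : ℝ}
  (h : IsErgodicFamily (π.chainKernel Θ) d (fun θ t => π.nStep θ t) c ρ)
  (hb : ∀ k x a x', |M.shapedCost k x a x'| ≤ b)
include h hb

theorem localGrad_prop (k : Fin (K + 1)) : IsUnifCont (π.localGrad Θ d k) ∧
    ∃ b', 0 ≤ b' ∧ IsBddMeas (π.localGrad Θ d k) b' := by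
  obtain ⟨hU, bq, hbq0, hbq⟩ := hM.valueAt_prop h hb k
  obtain ⟨hUg, bg, hbg0, hbg⟩ := hM.gradDens_prop
  exact ⟨IsUnifCont.integral_snd (hU.smul hUg hbq.le hbg.le) (hbq.smul hbg hbq0), _,
    by positivity, IsBddMeas.integral_snd (hbq.smul hbg hbq0)⟩

theorem integrable_mul_valueAt (k : Fin (K + 1)) (θ : Θ) (x : M.X) {f : M.A → ℝ}
    (hf : Integrable f π.ref) :
    Integrable (fun a => f a * π.valueAt Θ d k θ (x, a)) π.ref := by
  obtain ⟨-, bq, hbq0, hbq⟩ := hM.valueAt_prop h hb k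
  exact hf.mul_bdd
    ((hbq.sm θ).comp_measurable (measurable_prodMk_left (x := x))).aestronglyMeasurable
    (Eventually.of_forall fun a => hbq.le θ (x, a))

/-- The value is taken at θ while actions follow θ'. Keeping the two apart is what the performance
difference formula needs. -/
theorem integral_densAt_mul_valueAt (k : Fin (K + 1)) (θ θ' : Θ) (x : M.X) :
    ∫ a, π.densAt Θ θ' (x, a) * π.valueAt Θ d k θ (x, a) ∂π.ref =
      π.meanAt Θ k θ' x - π.fdot k θ + ∫ y, π.relValue Θ d k θ y ∂π.chainKernel Θ (θ', x) := by
  obtain ⟨-, bv, -, hbv⟩ := hM.relValue_prop h hb k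
  have i0 := hM.integrable_densAt θ' x
  have i1 : Integrable (fun a => π.densAt Θ θ' (x, a) * M.expCost k (x, a)) π.ref :=
    i0.mul_bdd ((M.stronglyMeasurable_expCost k).comp_measurable
      (measurable_prodMk_left (x := x))).aestronglyMeasurable
      (Eventually.of_forall fun a => abs_expCost_le hb k (x, a))
  have hW := hbv.integral_kernel (κ := M.augTrans)
  have i2 : Integrable (fun a => π.densAt Θ θ' (x, a) *
      ∫ x', π.relValue Θ d k θ x' ∂M.augTrans (x, a)) π.ref :=
    i0.mul_bdd ((hW.sm θ).comp_measurable (measurable_prodMk_left (x := x))).aestronglyMeasurable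
      (Eventually.of_forall fun a => hW.le θ (x, a))
  rw [hM.meanAt_eq hb, hM.integral_chainKernel θ' x (hbv.sm θ) (hbv.le θ)]
  simp only [Policy.valueAt, ← hM.fdot_eq h hb, smul_eq_mul, mul_add, mul_neg]
  have i3 : Integrable (fun a => -(π.densAt Θ θ' (x, a) * π.fdot k θ)) π.ref :=
    (i0.mul_const _).neg
  rw [integral_add (f := fun a => π.densAt Θ θ' (x, a) * M.expCost k (x, a) +
    -(π.densAt Θ θ' (x, a) * π.fdot k θ)) (i1.add i3) i2, integral_add i1 i3, integral_neg,
    integral_mul_const, hM.integral_densAt, one_mul, sub_eq_add_neg]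

/-- The performance difference formula. -/
theorem fdot_sub_eq (k : Fin (K + 1)) (θ θ' : Θ) :
    π.fdot k θ' - π.fdot k θ =
      ∫ x, ∫ a, (π.densAt Θ θ' (x, a) - π.densAt Θ θ (x, a)) * π.valueAt Θ d k θ (x, a) ∂π.ref
        ∂d θ' := by
  obtain ⟨-, bv, -, hbv⟩ := hM.relValue_prop h hb k
  have hF := hM.isBddMeas_meanAt hb k
  have := h.isProb θ'
  -- The relative value at θ is treated as a family constant in the parameter, so that invariance
  -- can be used at θ'.
  have hc : IsBddMeas (fun (_ : Θ) x => π.relValue Θ d k θ x) bv :=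
    IsBddMeas.const (hbv.sm θ) (hbv.le θ)
  have e : ∀ x, ∫ a, (π.densAt Θ θ' (x, a) - π.densAt Θ θ (x, a)) *
      π.valueAt Θ d k θ (x, a) ∂π.ref = π.meanAt Θ k θ' x - π.fdot k θ +
        (push (π.chainKernel Θ) (fun (_ : Θ) x => π.relValue Θ d k θ x) θ' x -
          π.relValue Θ d k θ x) := by
    intro x
    have h1 := h.poisson_eq hF θ x
    simp_rw [sub_mul]
    rw [integral_sub (hM.integrable_mul_valueAt h hb k θ x (hM.integrable_densAt θ' x))
      (hM.integrable_mul_valueAt h hb k θ x (hM.integrable_densAt θ x)),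
      hM.integral_densAt_mul_valueAt h hb, hM.integral_densAt_mul_valueAt h hb,
      hM.fdot_eq h hb k θ]
    simp only [push, Policy.relValue] at h1 ⊢
    linarith
  simp_rw [e]
  have i1 := hF.integrable θ' (d θ')
  have i2 := (hc.push h.isMarkov).integrable θ' (d θ')
  have i3 := hc.integrable θ' (d θ')
  have i4 : Integrable (fun x => π.meanAt Θ k θ' x - π.fdot k θ) (d θ') :=
    i1.sub (integrable_const _)
  have i5 : Integrable (fun x => push (π.chainKernel Θ) (fun (_ : Θ) x => π.relValue Θ d k θ x) θ' x
      - π.relValue Θ d k θ x) (d θ') := i2.sub i3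
  -- Under the stationary law of θ' the relative value and its push have equal integrals and cancel.
  rw [integral_add i4 i5, integral_sub i1 (integrable_const _),
    integral_sub i2 i3, h.invariant_integral hc, hM.fdot_eq h hb k θ']
  simp

/-- The policy gradient theorem. -/
theorem gradF_eq (k : Fin (K + 1)) (θ : Θ) :
    π.gradF Θ k θ = ∫ x, π.localGrad Θ d k θ x ∂d θ := by
  have key : HasGradientWithinAt (π.fdot k) (∫ x, π.localGrad Θ d k θ x ∂d θ) Θ θ := by
    refine hasGradientWithinAt_of_forall fun ε hε => ?_
    obtain ⟨hU, bq, hbq0, hbq⟩ := hM.valueAt_prop h hb k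
    obtain ⟨-, bg, hbg0, hbg⟩ := hM.localGrad_prop h hb k
    -- With the local gradient frozen at θ, only the stationary law varies. Continuity of its means
    -- suffices, since the performance difference is already of first order in θ' - θ; the
    -- stationary law need not be differentiable.
    have hc : IsBddMeas (fun (_ : Θ) x => π.localGrad Θ d k θ x) bg :=
      IsBddMeas.const (hbg.sm θ) (hbg.le θ)
    obtain ⟨δ, hδ, h1⟩ := hM.dens_taylor (ε / 2 / (bq * π.ref.real univ + 1)) (by positivity)
    obtain ⟨δ', hδ', h2⟩ := h.isUnifCont_mean hc hM.chainKernel_lipschitz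
      (IsUnifCont.const _) (ε / 2) (by positivity)
    refine ⟨min δ δ', lt_min hδ hδ', fun θ₁ hθ₁ hd => ?_⟩
    obtain ⟨θ', rfl⟩ : ∃ θ' : Θ, (θ' : EuclideanSpace ℝ (Fin nθ)) = θ₁ := ⟨⟨θ₁, hθ₁⟩, rfl⟩
    have hd' : dist θ θ' < min δ δ' := hd
    have := h.isProb θ
    have := h.isProb θ'
    set D : EuclideanSpace ℝ (Fin nθ) := (θ' : EuclideanSpace ℝ (Fin nθ)) - θ with hD
    -- The inner integral of the performance difference splits into its linear part and the Taylor
    -- remainder of the density.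
    have hx : ∀ x, ∫ a, (π.densAt Θ θ' (x, a) - π.densAt Θ θ (x, a)) *
        π.valueAt Θ d k θ (x, a) ∂π.ref = inner ℝ D (π.localGrad Θ d k θ x) +
        ∫ a, (π.densAt Θ θ' (x, a) - π.densAt Θ θ (x, a) -
          inner ℝ D (π.gradDens Θ θ (x, a))) * π.valueAt Θ d k θ (x, a) ∂π.ref := by
      intro x
      have i0 : Integrable (fun a => π.densAt Θ θ' (x, a) - π.densAt Θ θ (x, a) -
          inner ℝ D (π.gradDens Θ θ (x, a))) π.ref :=
        ((hM.integrable_densAt θ' x).sub (hM.integrable_densAt θ x)).sub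
          ((hM.integrable_gradDens θ x).const_inner (𝕜 := ℝ) D)
      have i2 : Integrable (fun a => π.valueAt Θ d k θ (x, a) • π.gradDens Θ θ (x, a)) π.ref :=
        (hM.integrable_gradDens θ x).bdd_smul bq
          ((hbq.sm θ).comp_measurable (measurable_prodMk_left (x := x))).aestronglyMeasurable
          (Eventually.of_forall fun a => hbq.le θ (x, a))
      rw [Policy.localGrad, ← integral_inner i2, ← integral_add (i2.const_inner D)
        (hM.integrable_mul_valueAt h hb k θ x i0)]
      refine integral_congr_ae (Eventually.of_forall fun a => ?_)
      simp only [inner_smul_right]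
      ring
    have hR : ∀ x, ‖∫ a, (π.densAt Θ θ' (x, a) - π.densAt Θ θ (x, a) -
          inner ℝ D (π.gradDens Θ θ (x, a))) * π.valueAt Θ d k θ (x, a) ∂π.ref‖ ≤
        ε / 2 * dist θ θ' := by
      intro x
      refine (norm_integral_le_of_norm_le_const (C := ε / 2 / (bq * π.ref.real univ + 1) *
        dist θ θ' * bq) (Eventually.of_forall fun a => ?_)).trans ?_
      · rw [norm_mul]
        exact mul_le_mul (h1 θ θ' (hd'.trans_le (min_le_left _ _)) (x, a)) (hbq.le θ (x, a))
          (norm_nonneg _) (by positivity)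
      · have : ε / 2 / (bq * π.ref.real univ + 1) * dist θ θ' * bq * π.ref.real univ =
          (ε / 2 * dist θ θ') * (bq * π.ref.real univ / (bq * π.ref.real univ + 1)) := by ring
        rw [this]
        refine mul_le_of_le_one_right (by positivity) ?_
        rw [div_le_one (by positivity)]
        linarith
    have i1 : Integrable (fun x => inner ℝ D (π.localGrad Θ d k θ x)) (d θ') :=
      (hc.integrable θ' (d θ')).const_inner D
    have i3 : Integrable (fun x => ∫ a, (π.densAt Θ θ' (x, a) - π.densAt Θ θ (x, a) -
          inner ℝ D (π.gradDens Θ θ (x, a))) * π.valueAt Θ d k θ (x, a) ∂π.ref) (d θ') := by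
      refine Integrable.of_bound ?_ (ε / 2 * dist θ θ') (Eventually.of_forall hR)
      obtain ⟨-, bd, -, hbd⟩ := hM.dens_prop
      obtain ⟨-, bg', -, hbg'⟩ := hM.gradDens_prop
      refine (StronglyMeasurable.integral_prod_right' (f := fun q : M.X × M.A =>
        (π.densAt Θ θ' q - π.densAt Θ θ q - inner ℝ D (π.gradDens Θ θ q)) *
          π.valueAt Θ d k θ q) ?_).aestronglyMeasurable
      exact (((hbd.sm θ').sub (hbd.sm θ)).sub (stronglyMeasurable_const.inner (hbg'.sm θ))).mul
        (hbq.sm θ)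
    have h3 : ‖∫ x, ∫ a, (π.densAt Θ θ' (x, a) - π.densAt Θ θ (x, a) -
          inner ℝ D (π.gradDens Θ θ (x, a))) * π.valueAt Θ d k θ (x, a) ∂π.ref ∂d θ'‖ ≤
        ε / 2 * dist θ θ' := by
      simpa using norm_integral_le_of_norm_le_const (μ := d θ') (Eventually.of_forall hR)
    have h4 : |inner ℝ D ((∫ x, π.localGrad Θ d k θ x ∂d θ') - ∫ x, π.localGrad Θ d k θ x ∂d θ)| ≤
        ε / 2 * dist θ θ' := by
      refine (abs_real_inner_le_norm _ _).trans ?_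
      have hDd : ‖D‖ = dist θ θ' := by rw [hD, ← dist_eq_norm, dist_comm]; rfl
      rw [mul_comm, hDd]
      refine mul_le_mul_of_nonneg_right ?_ dist_nonneg
      obtain ⟨x⟩ := nonempty_of_isProbabilityMeasure (d θ)
      rw [norm_sub_rev]
      exact h2 θ θ' (hd'.trans_le (min_le_right _ _)) x
    rw [hM.fdot_sub_eq h hb k θ θ']
    simp_rw [hx]
    rw [integral_add i1 i3, integral_inner (hc.integrable θ' (d θ'))]
    rw [inner_sub_right] at h4
    rw [Real.norm_eq_abs] at h3
    have e : ∀ p q r : ℝ, p + q - r = (p - r) + q := fun p q r => by ring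
    rw [e]
    refine (abs_add_le _ _).trans ?_
    have : dist (θ : EuclideanSpace ℝ (Fin nθ)) θ' = dist θ θ' := rfl
    rw [this]
    linarith
  have h3 := (hM.differentiable k θ θ.2).hasGradientWithinAt
  exact (InnerProductSpace.toDual ℝ _).injective
    ((hM.uniqueDiffOn θ θ.2).eq h3.hasFDerivWithinAt key.hasFDerivWithinAt)

end ProblemAssumptions

end CACRL

namespace CACRL

/-! ### Block sums -/

theorem sum_range_mul_eq {E : Type*} [AddCommMonoid E] (f : ℕ → E) (B n : ℕ) :
    ∑ t ∈ Finset.range (n * B), f t =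
      ∑ i ∈ Finset.range n, ∑ j ∈ Finset.range B, f (i * B + j) := by
  induction n with
  | zero => simp
  | succ n ih => rw [Nat.succ_mul, Finset.sum_range_add, ih, Finset.sum_range_succ]

theorem block_div {B i j : ℕ} (hj : j < B) : (i * B + j) / B = i := by
  rw [mul_comm, Nat.mul_add_div (by omega), Nat.div_eq_of_lt hj, add_zero]

theorem summable_block {g : ℕ → ℝ} (hg : Summable g) (hg0 : ∀ i, 0 ≤ g i) {B : ℕ} (hB : 0 < B) :
    Summable fun t => g (t / B) := by
  refine summable_of_sum_range_le (c := B * ∑' i, g i) (fun t => hg0 _) fun n => ?_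
  have h1 : ∑ t ∈ Finset.range n, g (t / B) ≤ ∑ t ∈ Finset.range (n * B), g (t / B) :=
    Finset.sum_le_sum_of_subset_of_nonneg
      (Finset.range_mono (Nat.le_mul_of_pos_right n hB)) fun _ _ _ => hg0 _
  refine h1.trans ?_
  rw [sum_range_mul_eq]
  have h2 : ∀ i ∈ Finset.range n, ∑ j ∈ Finset.range B, g ((i * B + j) / B) = B * g i := by
    intro i _
    rw [Finset.sum_congr rfl fun j hj => by rw [block_div (Finset.mem_range.1 hj)]]
    simp
  rw [Finset.sum_congr rfl h2, ← Finset.mul_sum]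
  exact mul_le_mul_of_nonneg_left (hg.sum_le_tsum _ fun i _ => hg0 i) (Nat.cast_nonneg B)

/-! ### Runs of the algorithm -/

theorem IsActorSolution.mem {n K : ℕ} {Θ : Set (EuclideanSpace ℝ (Fin n))}
    {F : Fin (K + 1) → EuclideanSpace ℝ (Fin n) → ℝ} {θb : EuclideanSpace ℝ (Fin n)}
    (h : IsActorSolution Θ F θb) : θb ∈ Θ := by
  by_cases hf : ∃ θ ∈ Θ, ∀ k : Fin K, F k.succ θ ≤ 0
  · exact (h.1 hf).1
  · exact (h.2 hf).1

variable {nS nZ nA K nθ nω : ℕ} {M : CMDP nS nZ nA K} {π : Policy M nθ}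
  {Θ : Set (EuclideanSpace ℝ (Fin nθ))} {B : ℕ} {η μ : ℕ → ℝ} {ζ : Fin (K + 1) → ℝ}
  {Qnet : Fin (K + 1) → EuclideanSpace ℝ (Fin nω) → M.X → M.A → ℝ}
  {Ω : Type*} [mΩ : MeasurableSpace Ω] {P : Measure Ω}

namespace Run

variable (R : Run M π Θ B η μ ζ Qnet P)

theorem θ_mem (hM : ProblemAssumptions M π Θ) (hs : StepSizeAssumptions η μ) (i : ℕ) (ω : Ω) :
    R.θ i ω ∈ Θ := by
  induction i with
  | zero => exact R.θ_zero ω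
  | succ i ih =>
    rw [R.θ_succ]
    exact hM.convex_Θ ih (R.θbar_spec i ω).mem (by linarith [hs.le_one_μ (i + 1)])
      (hs.pos_μ _).le (by ring)

/-- The parameters as points of `Θ`. -/
def par (hM : ProblemAssumptions M π Θ) (hs : StepSizeAssumptions η μ) (i : ℕ) (ω : Ω) : Θ :=
  ⟨R.θ i ω, R.θ_mem hM hs i ω⟩

variable (hM : ProblemAssumptions M π Θ) (hs : StepSizeAssumptions η μ)

/-- An update is μ times a vector joining two points of Θ, so the diameter of Θ serves as the
constant. -/
theorem exists_dist_par_le : ∃ D : ℝ, 0 ≤ D ∧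
    ∀ i ω, dist (R.par hM hs (i + 1) ω) (R.par hM hs i ω) ≤ D * μ (i + 1) := by
  refine ⟨Metric.diam Θ, Metric.diam_nonneg, fun i ω => ?_⟩
  have e : R.θ (i + 1) ω - R.θ i ω = μ (i + 1) • (R.θbar i ω - R.θ i ω) := by
    rw [R.θ_succ]; module
  change dist (R.θ (i + 1) ω) (R.θ i ω) ≤ _
  rw [dist_eq_norm, e, norm_smul, Real.norm_of_nonneg (hs.pos_μ _).le, mul_comm, ← dist_eq_norm]
  exact mul_le_mul_of_nonneg_right (Metric.dist_le_diam_of_mem hM.isCompact_Θ.isBounded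
    (R.θbar_spec i ω).mem (R.θ_mem hM hs i ω)) (hs.pos_μ _).le

theorem tendsto_dist_par (ω : Ω) :
    Tendsto (fun i => dist (R.par hM hs i ω) (R.par hM hs (i + 1) ω)) atTop (𝓝 0) := by
  obtain ⟨D, -, h⟩ := R.exists_dist_par_le hM hs
  refine squeeze_zero (fun i => dist_nonneg) (fun i => (dist_comm _ _).trans_le (h i ω)) ?_
  simpa using ((tendsto_add_atTop_iff_nat 1).2 hs.tendsto_μ).const_mul D

theorem measurable_par (i : ℕ) : Measurable[R.ℱ (i * B)] (R.par hM hs i) :=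
  (R.measurable_θ i).subtype_mk

theorem measurable_step (t : ℕ) :
    Measurable[R.ℱ (t + 1)] fun ω => (R.a t ω, R.x (t + 1) ω) :=
  (R.measurable_a t).prodMk (R.measurable_x (t + 1))

/-- The parameter in force and the current state. -/
def known (t : ℕ) (ω : Ω) : Θ × M.X := (R.par hM hs (t / B) ω, R.x t ω)

theorem measurable_known (t : ℕ) : Measurable[R.ℱ t] (R.known hM hs t) :=
  ((R.measurable_par hM hs (t / B)).mono (R.ℱ.mono (Nat.div_mul_le_self t B)) le_rfl).prodMk
    (R.measurable_x t)

/-- The estimate used in batch i depends only on earlier data, which makes the baseline of the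
surrogate value function predictable. -/
theorem measurable_fhat (i : ℕ) (k : Fin (K + 1)) :
    Measurable[R.ℱ (i * B)] fun ω => R.fhat i ω k := by
  induction i with
  | zero =>
    rw [zero_mul]
    exact (measurable_pi_apply k).comp R.measurable_fhat_zero
  | succ i ih =>
    simp_rw [R.fhat_succ]
    have h1 : ∀ j ∈ Finset.range B, Measurable[R.ℱ ((i + 1) * B)] fun ω =>
        M.shapedCost k (R.x (i * B + j) ω) (R.a (i * B + j) ω) (R.x (i * B + j + 1) ω) := by
      intro j hj
      have hj' : i * B + j + 1 ≤ (i + 1) * B := by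
        rw [Nat.succ_mul]; have := Finset.mem_range.1 hj; omega
      have hx := (R.measurable_x (i * B + j)).mono (R.ℱ.mono ((Nat.le_succ _).trans hj')) le_rfl
      have ha := (R.measurable_a (i * B + j)).mono (R.ℱ.mono hj') le_rfl
      have hx' := (R.measurable_x (i * B + j + 1)).mono (R.ℱ.mono hj') le_rfl
      exact (M.measurable_shapedCost k).comp ((hx.prodMk ha).prodMk hx')
    have h2 : Measurable[R.ℱ ((i + 1) * B)] fun ω => R.fhat i ω k :=
      ih.mono (R.ℱ.mono (Nat.mul_le_mul_right B (Nat.le_succ i))) le_rfl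
    have h3 := Finset.measurable_fun_sum (m := R.ℱ ((i + 1) * B)) (Finset.range B) h1
    exact (h2.const_mul (1 - η (i + 1))).add ((h3.const_mul (B : ℝ)⁻¹).const_mul (η i))

variable [IsProbabilityMeasure P] {E : Type*} [NormedAddCommGroup E] [NormedSpace ℝ E]

theorem condExp_step [CompleteSpace E] {G : (Θ × M.X) × (M.A × M.X) → E} (hG : StronglyMeasurable G)
    {b : ℝ} (hb : ∀ q, ‖G q‖ ≤ b) (t : ℕ) :
    P[fun ω => G (R.known hM hs t ω, R.a t ω, R.x (t + 1) ω) | R.ℱ t] =ᵐ[P]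
      fun ω => ∫ p, G (R.known hM hs t ω, p) ∂π.stepKernel Θ (R.known hM hs t ω) := by
  have := hM.isMarkovKernel_stepKernel
  refine condExp_eq_integral_kernel (R.ℱ.le t) (R.measurable_known hM hs t)
    (Y := fun ω => (R.a t ω, R.x (t + 1) ω))
    ((R.measurable_step t).mono (R.ℱ.le _) le_rfl) (π.stepKernel Θ) (fun U hU => ?_) hG hb
  refine (R.law_step t U hU).trans (Eventually.of_forall fun ω => ?_)
  simp only
  rw [← hM.step_apply]
  rfl

/-- The deviation of `G` from its conditional mean. -/
noncomputable def noise (G : (Θ × M.X) × (M.A × M.X) → E) (t : ℕ) (ω : Ω) : E :=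
  G (R.known hM hs t ω, R.a t ω, R.x (t + 1) ω) -
    ∫ p, G (R.known hM hs t ω, p) ∂π.stepKernel Θ (R.known hM hs t ω)

/-- The martingale runs in individual time steps, with weights constant on each batch and known when
it starts. Repeating each weight B times preserves square summability. -/
theorem ae_exists_tendsto_noise [FiniteDimensional ℝ E] (hB : 0 < B)
    {G : (Θ × M.X) × (M.A × M.X) → E} (hG : StronglyMeasurable G) {b : ℝ} (hb : ∀ q, ‖G q‖ ≤ b)
    {c : ℕ → Ω → ℝ} {γ : ℕ → ℝ} (hc : ∀ i, Measurable[R.ℱ (i * B)] (c i))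
    (hcγ : ∀ i ω, |c i ω| ≤ γ i) (hγ : Summable fun i => γ i ^ 2) :
    ∀ᵐ ω ∂P, ∃ l, Tendsto (fun n => ∑ i ∈ Finset.range n,
      c i ω • ∑ j ∈ Finset.range B, R.noise hM hs G (i * B + j) ω) atTop (𝓝 l) := by
  have : CompleteSpace E := FiniteDimensional.complete ℝ E
  have := hM.isMarkovKernel_stepKernel
  have hmean : ∀ w, ‖∫ p, G (w, p) ∂π.stepKernel Θ w‖ ≤ b := fun w => by
    simpa using norm_integral_le_of_norm_le_const (μ := π.stepKernel Θ w)
      (Eventually.of_forall fun p => hb (w, p))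
  have sm1 : ∀ t, StronglyMeasurable[R.ℱ (t + 1)]
      fun ω => G (R.known hM hs t ω, R.a t ω, R.x (t + 1) ω) := fun t =>
    hG.comp_measurable (((R.measurable_known hM hs t).mono (R.ℱ.mono (Nat.le_succ t)) le_rfl).prodMk
      (R.measurable_step t))
  have sm2 : ∀ t, StronglyMeasurable[R.ℱ t]
      fun ω => ∫ p, G (R.known hM hs t ω, p) ∂π.stepKernel Θ (R.known hM hs t ω) := fun t =>
    (hG.integral_kernel_prod_right' (κ := π.stepKernel Θ)).comp_measurable
      (R.measurable_known hM hs t)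
  have hconv := ae_exists_tendsto_sum_smul (P := P) (ℱ := R.ℱ) (D := R.noise hM hs G)
    (c := fun t => c (t / B)) (γ := fun t => γ (t / B)) (b := b + b)
    (fun t => (sm1 t).sub ((sm2 t).mono (R.ℱ.mono (Nat.le_succ t))))
    (fun t ω => (norm_sub_le _ _).trans (add_le_add (hb _) (hmean _)))
    (fun t => by
      have i1 : Integrable (fun ω => G (R.known hM hs t ω, R.a t ω, R.x (t + 1) ω)) P :=
        Integrable.of_bound ((sm1 t).mono (R.ℱ.le _)).aestronglyMeasurable b
          (Eventually.of_forall fun ω => hb _)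
      have i2 : Integrable
          (fun ω => ∫ p, G (R.known hM hs t ω, p) ∂π.stepKernel Θ (R.known hM hs t ω)) P :=
        Integrable.of_bound ((sm2 t).mono (R.ℱ.le _)).aestronglyMeasurable b
          (Eventually.of_forall fun ω => hmean _)
      refine (condExp_sub i1 i2 (R.ℱ t)).trans ?_
      rw [condExp_of_stronglyMeasurable (R.ℱ.le t) (sm2 t) i2]
      filter_upwards [R.condExp_step hM hs hG hb t] with ω hω
      simp [hω])
    (fun t => ((hc (t / B)).mono (R.ℱ.mono (Nat.div_mul_le_self t B)) le_rfl).stronglyMeasurable)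
    (fun t ω => hcγ _ ω) (summable_block hγ (fun i => sq_nonneg _) hB)
  filter_upwards [hconv] with ω ⟨l, hl⟩
  -- Sums over n complete batches are the partial sums of the time series at n * B.
  refine ⟨l, (hl.comp (tendsto_id.atTop_mul_const' hB)).congr fun n => ?_⟩
  simp only [Function.comp_apply, id_eq]
  rw [sum_range_mul_eq]
  refine Finset.sum_congr rfl fun i _ => ?_
  rw [Finset.smul_sum]
  exact Finset.sum_congr rfl fun j hj => by rw [block_div (Finset.mem_range.1 hj)]

variable {d : Θ → Measure M.X} {c ρ : ℝ}
  (h : IsErgodicFamily (π.chainKernel Θ) d (fun θ t => π.nStep θ t) c ρ)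
include h

/-- Batch means of `G` along a run average out to the stationary means. -/
theorem ae_exists_tendsto_batch [FiniteDimensional ℝ E] (hB : 0 < B)
    {G : (Θ × M.X) × (M.A × M.X) → E} (hG : StronglyMeasurable G) {b : ℝ} (hb : ∀ q, ‖G q‖ ≤ b)
    {F : Θ → M.X → E} (hF : ∀ θ x, F θ x = ∫ p, G ((θ, x), p) ∂π.stepKernel Θ (θ, x))
    (hU : IsUnifCont F) :
    ∀ᵐ ω ∂P, ∃ r : ℕ → E, Tendsto r atTop (𝓝 0) ∧ ∃ l, Tendsto (fun n => ∑ i ∈ Finset.range n,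
      η i • ((B : ℝ)⁻¹ • ∑ j ∈ Finset.range B, G ((R.par hM hs i ω, R.x (i * B + j) ω),
        R.a (i * B + j) ω, R.x (i * B + j + 1) ω) - ∫ x, F (R.par hM hs i ω) x ∂d (R.par hM hs i ω)
          - r i)) atTop (𝓝 l) := by
  have : CompleteSpace E := FiniteDimensional.complete ℝ E
  have := hM.isMarkovKernel_stepKernel
  have hFb : IsBddMeas F b := by
    have e : Function.uncurry F = fun w => ∫ p, G (w, p) ∂π.stepKernel Θ w := by
      ext w; exact hF w.1 w.2
    refine ⟨?_, fun θ x => ?_⟩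
    · rw [e]; exact hG.integral_kernel_prod_right' (κ := π.stepKernel Θ)
    · rw [hF]
      simpa using norm_integral_le_of_norm_le_const (μ := π.stepKernel Θ (θ, x))
        (Eventually.of_forall fun p => hb ((θ, x), p))
  set v := poisson (π.chainKernel Θ) d F with hv
  set bv := ∑' t, b * (c * ρ ^ t)
  have hvb : IsBddMeas v bv := h.isBddMeas_poisson hFb
  have hvU : IsUnifCont v := h.isUnifCont_poisson hFb hM.chainKernel_lipschitz hU
  -- Adding v at the next state lets a single noise term cover both the fluctuation of G and the
  -- martingale part of the increment of v.
  have hG' : StronglyMeasurable fun q : (Θ × M.X) × (M.A × M.X) => G q + v q.1.1 q.2.2 :=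
    hG.add (hvb.meas.comp_measurable
      (g := fun q : (Θ × M.X) × (M.A × M.X) => (q.1.1, q.2.2)) (by fun_prop))
  have hBne : (B : ℝ) ≠ 0 := by exact_mod_cast hB.ne'
  -- By the Poisson equation, the deviation from the stationary mean is noise plus a difference that
  -- telescopes within the batch, where the parameter is fixed.
  have hterm : ∀ ω i j, j < B → G ((R.par hM hs i ω, R.x (i * B + j) ω),
        R.a (i * B + j) ω, R.x (i * B + j + 1) ω) -
          ∫ x, F (R.par hM hs i ω) x ∂d (R.par hM hs i ω) =
      R.noise hM hs (fun q => G q + v q.1.1 q.2.2) (i * B + j) ω +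
        (v (R.par hM hs i ω) (R.x (i * B + j) ω) -
          v (R.par hM hs i ω) (R.x (i * B + (j + 1)) ω)) := by
    intro ω i j hj
    have h1 := h.poisson_eq hFb (R.par hM hs i ω) (R.x (i * B + j) ω)
    have h2 : ∫ p, (G ((R.par hM hs i ω, R.x (i * B + j) ω), p) + v (R.par hM hs i ω) p.2)
        ∂π.stepKernel Θ (R.par hM hs i ω, R.x (i * B + j) ω) =
        F (R.par hM hs i ω) (R.x (i * B + j) ω) +
          push (π.chainKernel Θ) v (R.par hM hs i ω) (R.x (i * B + j) ω) := by
      rw [integral_add, hF, push, Policy.chainKernel, Kernel.snd_apply,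
        integral_map measurable_snd.aemeasurable (hvb.sm _).aestronglyMeasurable]
      · exact Integrable.of_bound (hG.comp_measurable measurable_prodMk_left).aestronglyMeasurable b
          (Eventually.of_forall fun p => hb _)
      · exact Integrable.of_bound
          ((hvb.sm _).comp_measurable measurable_snd).aestronglyMeasurable bv
          (Eventually.of_forall fun p => hvb.le _ _)
    rw [noise, known, block_div hj, h2]
    rw [← hv] at h1
    have h3 : ∫ x, F (R.par hM hs i ω) x ∂d (R.par hM hs i ω) =
        F (R.par hM hs i ω) (R.x (i * B + j) ω) - (v (R.par hM hs i ω) (R.x (i * B + j) ω) -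
          push (π.chainKernel Θ) v (R.par hM hs i ω) (R.x (i * B + j) ω)) := by
      rw [h1]; abel
    rw [h3, ← add_assoc (i * B) j 1]
    abel
  have hconv := R.ae_exists_tendsto_noise hM hs hB hG' (b := b + bv)
    (fun q => (norm_add_le _ _).trans (add_le_add (hb q) (hvb.le _ _)))
    (c := fun i _ => η i * (B : ℝ)⁻¹) (γ := fun i => η i * (B : ℝ)⁻¹)
    (fun i => measurable_const)
    (fun i ω => by
      rw [abs_of_nonneg]; exact mul_nonneg (hs.pos_η i).le (by positivity))
    (by simp_rw [mul_pow]; exact hs.sum_sq_η.mul_right _)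
  filter_upwards [hconv] with ω ⟨l, hl⟩
  -- Abel summation needs the batch endpoints to match, so u evaluates v at the parameter of the
  -- batch that begins there.
  obtain ⟨l', hl'⟩ := hs.exists_tendsto_sum_smul_sub
    (u := fun i => v (R.par hM hs i ω) (R.x (i * B) ω)) (b := bv) (fun i => hvb.le _ _)
  -- The bias is the cost of switching the parameter in v at a batch boundary. Uniform continuity
  -- makes it vanish, though not necessarily summable, so it is kept as a separate sequence.
  refine ⟨fun i => (B : ℝ)⁻¹ • (v (R.par hM hs (i + 1) ω) (R.x ((i + 1) * B) ω) -
    v (R.par hM hs i ω) (R.x ((i + 1) * B) ω)), ?_, l + (B : ℝ)⁻¹ • l', ?_⟩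
  · have h0 : Tendsto (fun i => v (R.par hM hs (i + 1) ω) (R.x ((i + 1) * B) ω) -
        v (R.par hM hs i ω) (R.x ((i + 1) * B) ω)) atTop (𝓝 0) := by
      rw [tendsto_zero_iff_norm_tendsto_zero, Metric.tendsto_atTop]
      intro ε hε
      obtain ⟨δ, hδ, h1⟩ := hvU (ε / 2) (by positivity)
      obtain ⟨N, hN⟩ := eventually_atTop.1
        ((R.tendsto_dist_par hM hs ω).eventually (gt_mem_nhds hδ))
      refine ⟨N, fun n hn => ?_⟩
      have h2 := h1 _ _ (hN n hn) (R.x ((n + 1) * B) ω)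
      rw [norm_sub_rev] at h2
      rw [Real.dist_eq, sub_zero, abs_of_nonneg (norm_nonneg _)]
      linarith
    simpa using h0.const_smul ((B : ℝ)⁻¹)
  · refine (hl.add (hl'.const_smul (B : ℝ)⁻¹)).congr fun n => ?_
    rw [Finset.smul_sum, ← Finset.sum_add_distrib]
    refine Finset.sum_congr rfl fun i _ => ?_
    have h1 : ∑ j ∈ Finset.range B, (G ((R.par hM hs i ω, R.x (i * B + j) ω),
        R.a (i * B + j) ω, R.x (i * B + j + 1) ω) -
          ∫ x, F (R.par hM hs i ω) x ∂d (R.par hM hs i ω)) =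
        ∑ j ∈ Finset.range B, R.noise hM hs (fun q => G q + v q.1.1 q.2.2) (i * B + j) ω +
        (v (R.par hM hs i ω) (R.x (i * B) ω) - v (R.par hM hs i ω) (R.x ((i + 1) * B) ω)) := by
      rw [Finset.sum_congr rfl fun j hj => hterm ω i j (Finset.mem_range.1 hj),
        Finset.sum_add_distrib,
        Finset.sum_range_sub' (fun j => v (R.par hM hs i ω) (R.x (i * B + j) ω)), add_zero,
        Nat.succ_mul]
    have h2 : (B : ℝ)⁻¹ • ∑ j ∈ Finset.range B, G ((R.par hM hs i ω, R.x (i * B + j) ω),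
        R.a (i * B + j) ω, R.x (i * B + j + 1) ω) -
          ∫ x, F (R.par hM hs i ω) x ∂d (R.par hM hs i ω) =
        (B : ℝ)⁻¹ • ∑ j ∈ Finset.range B, (G ((R.par hM hs i ω, R.x (i * B + j) ω),
        R.a (i * B + j) ω, R.x (i * B + j + 1) ω) -
          ∫ x, F (R.par hM hs i ω) x ∂d (R.par hM hs i ω)) := by
      rw [Finset.sum_sub_distrib, smul_sub, Finset.sum_const, Finset.card_range,
        ← Nat.cast_smul_eq_nsmul ℝ, smul_smul, inv_mul_cancel₀ hBne, one_smul]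
    rw [h2, h1]
    module

end Run

end CACRL

/-! ### Tracking of the average costs and of their gradients -/

namespace CACRL

variable {nS nZ nA K nθ nω : ℕ} {M : CMDP nS nZ nA K} {π : Policy M nθ}
  {Θ : Set (EuclideanSpace ℝ (Fin nθ))} {B : ℕ} {η μ : ℕ → ℝ} {ζ : Fin (K + 1) → ℝ}
  {Qnet : Fin (K + 1) → EuclideanSpace ℝ (Fin nω) → M.X → M.A → ℝ}
  {Ω : Type*} [mΩ : MeasurableSpace Ω] {P : Measure Ω}

theorem norm_batch_le {E : Type*} [SeminormedAddCommGroup E] [NormedSpace ℝ E] {B : ℕ}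
    (hB : 0 < B) {f : ℕ → E} {c : ℝ} (hf : ∀ j, ‖f j‖ ≤ c) :
    ‖(B : ℝ)⁻¹ • ∑ j ∈ Finset.range B, f j‖ ≤ c := by
  have hB' : (0 : ℝ) < B := by exact_mod_cast hB
  rw [norm_smul, norm_inv, Real.norm_of_nonneg hB'.le]
  have h1 : ‖∑ j ∈ Finset.range B, f j‖ ≤ B * c := by
    refine (norm_sum_le_of_le _ fun j _ => hf j).trans (le_of_eq ?_)
    simp
  calc (B : ℝ)⁻¹ * ‖∑ j ∈ Finset.range B, f j‖ ≤ (B : ℝ)⁻¹ * (B * c) :=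
        mul_le_mul_of_nonneg_left h1 (by positivity)
    _ = c := by field_simp

theorem tendsto_enorm_zero {E : Type*} [NormedAddCommGroup E] {r : ℕ → E}
    (h : Tendsto r atTop (𝓝 0)) : Tendsto (fun i => ‖r i‖ₑ) atTop (𝓝 0) := by
  simpa using h.enorm

namespace ProblemAssumptions

variable (hM : ProblemAssumptions M π Θ)
include hM

/-- A bounded gradient on a convex set. Combined with the size of the parameter steps, this makes
the target slow. -/
theorem exists_lipschitz_fdot (k : Fin (K + 1)) : ∃ L, 0 ≤ L ∧ ∀ θ θ' : Θ,
    ‖π.fdot k θ - π.fdot k θ'‖ ≤ L * dist θ θ' := by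
  obtain ⟨L, hL⟩ := hM.gradient_bounded
  refine ⟨|L|, abs_nonneg _, fun θ θ' => ?_⟩
  have h := hM.convex_Θ.norm_image_sub_le_of_norm_hasFDerivWithin_le (f := π.fdot k)
    (f' := fun ξ => InnerProductSpace.toDual ℝ _ (π.gradF Θ k ξ)) (C := |L|)
    (fun ξ hξ => (hM.differentiable k ξ hξ).hasGradientWithinAt.hasFDerivWithinAt)
    (fun ξ hξ => by
      rw [LinearIsometryEquiv.norm_map]
      exact (hL k ξ hξ).trans (le_abs_self _)) θ'.2 θ.2
  rwa [← dist_eq_norm (θ : EuclideanSpace ℝ (Fin nθ))] at h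

theorem exists_lipschitz_gradF (k : Fin (K + 1)) : ∃ L, 0 ≤ L ∧ ∀ θ θ' : Θ,
    ‖π.gradF Θ k θ - π.gradF Θ k θ'‖ ≤ L * dist θ θ' := by
  obtain ⟨L, hL⟩ := hM.gradient_lipschitz
  refine ⟨L, L.2, fun θ θ' => ?_⟩
  rw [← dist_eq_norm]
  exact (hL k).dist_le_mul θ θ.2 θ' θ'.2

end ProblemAssumptions

namespace Run

variable (R : Run M π Θ B η μ ζ Qnet P) (hM : ProblemAssumptions M π Θ)
  (hs : StepSizeAssumptions η μ)

/-- The sample mean of the scores over the `i`-th observation set. -/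
noncomputable def scoreMean (R : Run M π Θ B η μ ζ Qnet P) (hM : ProblemAssumptions M π Θ)
    (hs : StepSizeAssumptions η μ) (i : ℕ) (ω : Ω) : EuclideanSpace ℝ (Fin nθ) :=
  (B : ℝ)⁻¹ • ∑ j ∈ Finset.range B,
    π.scoreAt Θ (R.par hM hs i ω) (R.x (i * B + j) ω, R.a (i * B + j) ω)

variable {d : Θ → Measure M.X} {c ρ b : ℝ}

include hM hs in
-- With the reshaped cost as sample, the bias of the batch means tends to 0, so tracking leaves no
-- error.
theorem ae_tendsto_fhat [IsProbabilityMeasure P]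
    (h : IsErgodicFamily (π.chainKernel Θ) d (fun θ t => π.nStep θ t) c ρ)
    (hb : ∀ k x a x', |M.shapedCost k x a x'| ≤ b) (hB : 0 < B) (k : Fin (K + 1)) :
    ∀ᵐ ω ∂P, Tendsto (fun i => |R.fhat i ω k - π.fdot k (R.θ i ω)|) atTop (𝓝 0) := by
  have hG : StronglyMeasurable fun q : (Θ × M.X) × (M.A × M.X) =>
      M.shapedCost k q.1.2 q.2.1 q.2.2 :=
    ((M.measurable_shapedCost k).comp (f := fun q : (Θ × M.X) × (M.A × M.X) =>
      ((q.1.2, q.2.1), q.2.2)) (by fun_prop)).stronglyMeasurable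
  have hbatch := R.ae_exists_tendsto_batch hM hs h hB hG (b := b) (fun q => hb k _ _ _)
    (F := π.meanAt Θ k) (fun θ x => by rw [← hM.step_apply]; rfl) (hM.isUnifCont_meanAt hb k)
  obtain ⟨L, hL0, hL⟩ := hM.exists_lipschitz_fdot k
  obtain ⟨D, hD0, hD⟩ := R.exists_dist_par_le hM hs
  filter_upwards [hbatch] with ω ⟨r, hr, l, hl⟩
  have hbound : ∀ i, ‖π.fdot k (R.par hM hs i ω)‖ ≤ b := fun i => by
    have := h.isProb (R.par hM hs i ω)
    rw [hM.fdot_eq h hb]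
    exact (hM.isBddMeas_meanAt hb k).norm_integral_le _ _
  have key := hs.limsup_tracking (est := fun i => R.fhat i ω k)
    (m := fun i => π.fdot k (R.par hM hs i ω)) (r := r) (L := L * D)
    (β := fun i => (B : ℝ)⁻¹ * ∑ j ∈ Finset.range B,
      M.shapedCost k (R.x (i * B + j) ω) (R.a (i * B + j) ω) (R.x (i * B + j + 1) ω)) hbound
    (fun i => (hL _ _).trans (by
      rw [mul_assoc]; exact mul_le_mul_of_nonneg_left (hD i ω) hL0))
    (fun i => R.fhat_succ i ω k) ⟨l, by simpa only [hM.fdot_eq h hb, smul_eq_mul] using hl⟩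
  rw [(tendsto_enorm_zero hr).limsup_eq] at key
  have h0 : Tendsto (fun i => ‖R.fhat i ω k - π.fdot k (R.par hM hs i ω)‖ₑ) atTop (𝓝 0) :=
    tendsto_of_le_liminf_of_limsup_le zero_le key
  have h1 := (ENNReal.tendsto_toReal ENNReal.zero_ne_top).comp h0
  refine h1.congr fun i => ?_
  simp only [Function.comp_apply, toReal_enorm]
  rfl

/-- Batch means of `Q`-weighted scores average out to the policy gradient. -/
theorem ae_exists_tendsto_policyGradient [IsProbabilityMeasure P]
    (h : IsErgodicFamily (π.chainKernel Θ) d (fun θ t => π.nStep θ t) c ρ)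
    (hb : ∀ k x a x', |M.shapedCost k x a x'| ≤ b) (hB : 0 < B) (k : Fin (K + 1)) :
    ∀ᵐ ω ∂P, ∃ r : ℕ → EuclideanSpace ℝ (Fin nθ), Tendsto r atTop (𝓝 0) ∧ ∃ l,
      Tendsto (fun n => ∑ i ∈ Finset.range n,
        η i • ((B : ℝ)⁻¹ • ∑ j ∈ Finset.range B,
          π.Q k (R.par hM hs i ω) (R.x (i * B + j) ω) (R.a (i * B + j) ω) •
            π.scoreAt Θ (R.par hM hs i ω) (R.x (i * B + j) ω, R.a (i * B + j) ω)
          - π.gradF Θ k (R.par hM hs i ω) - r i)) atTop (𝓝 l) := by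
  obtain ⟨-, bq, hbq0, hbq⟩ := hM.valueAt_prop h hb k
  obtain ⟨-, bs, hbs0, hbs⟩ := hM.scoreAt_prop
  have hQs := hbq.smul hbs hbq0
  have hG : StronglyMeasurable fun q : (Θ × M.X) × (M.A × M.X) =>
      π.valueAt Θ d k q.1.1 (q.1.2, q.2.1) • π.scoreAt Θ q.1.1 (q.1.2, q.2.1) :=
    hQs.meas.comp_measurable (g := fun q : (Θ × M.X) × (M.A × M.X) => (q.1.1, q.1.2, q.2.1))
      (by fun_prop)
  have hbatch := R.ae_exists_tendsto_batch hM hs h hB hG (b := bq * bs) (fun q => hQs.le _ _)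
    (F := π.localGrad Θ d k) (fun θ x => by
      refine Eq.trans ?_ (hM.integral_stepKernel_fst θ x (f := fun a =>
        π.valueAt Θ d k θ (x, a) • π.scoreAt Θ θ (x, a))
        ((hQs.sm θ).comp_measurable measurable_prodMk_left) (fun a => hQs.le _ _)).symm
      -- Density times score is the density gradient, so the conditional mean of the sample is
      -- `localGrad`.
      refine integral_congr_ae (Eventually.of_forall fun a => ?_)
      simp only
      rw [smul_comm, hM.densAt_smul_scoreAt]) (hM.localGrad_prop h hb k).1
  filter_upwards [hbatch] with ω ⟨r, hr, l, hl⟩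
  refine ⟨r, hr, l, ?_⟩
  simpa only [hM.Q_eq h hb, hM.gradF_eq h hb] using hl

/-- Scores with predictable bounded weights average out to zero. -/
theorem ae_exists_tendsto_score [IsProbabilityMeasure P] (hB : 0 < B) {δ : ℕ → Ω → ℝ} {n : ℝ}
    (hδ : ∀ i, Measurable[R.ℱ (i * B)] (δ i)) (hn : ∀ i ω, |δ i ω| ≤ n) :
    ∀ᵐ ω ∂P, ∃ l, Tendsto (fun N => ∑ i ∈ Finset.range N,
      (η i * δ i ω) • R.scoreMean hM hs i ω) atTop (𝓝 l) := by
  obtain ⟨-, bs, hbs0, hbs⟩ := hM.scoreAt_prop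
  have hG : StronglyMeasurable fun q : (Θ × M.X) × (M.A × M.X) =>
      π.scoreAt Θ q.1.1 (q.1.2, q.2.1) :=
    hbs.meas.comp_measurable (g := fun q : (Θ × M.X) × (M.A × M.X) => (q.1.1, q.1.2, q.2.1))
      (by fun_prop)
  -- Scores have conditional mean zero, so they coincide with their own martingale noise.
  have h0 : ∀ w : Θ × M.X, ∫ p, π.scoreAt Θ w.1 (w.2, p.1) ∂π.stepKernel Θ w = 0 := by
    rintro ⟨θ, x⟩
    refine (hM.integral_stepKernel_fst θ x (f := fun a => π.scoreAt Θ θ (x, a))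
      ((hbs.sm θ).comp_measurable measurable_prodMk_left) (fun a => hbs.le _ _)).trans ?_
    simp only [hM.densAt_smul_scoreAt, hM.integral_gradDens]
  have hconv := R.ae_exists_tendsto_noise hM hs hB hG (b := bs) (fun q => hbs.le _ _)
    (c := fun i ω => δ i ω * (η i * (B : ℝ)⁻¹)) (γ := fun i => n * (η i * (B : ℝ)⁻¹))
    (fun i => (hδ i).mul_const _)
    (fun i ω => by
      have : 0 ≤ η i * (B : ℝ)⁻¹ := mul_nonneg (hs.pos_η i).le (by positivity)
      rw [abs_mul, abs_of_nonneg this]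
      exact mul_le_mul_of_nonneg_right (hn i ω) this)
    (by simp_rw [mul_pow]; exact (hs.sum_sq_η.mul_right _).mul_left _)
  filter_upwards [hconv] with ω ⟨l, hl⟩
  refine ⟨l, hl.congr fun N => Finset.sum_congr rfl fun i _ => ?_⟩
  rw [scoreMean, smul_smul]
  congr 1
  · ring
  · refine Finset.sum_congr rfl fun j hj => ?_
    rw [noise, known, h0 (R.par hM hs ((i * B + j) / B) ω, R.x (i * B + j) ω), sub_zero,
      block_div (Finset.mem_range.1 hj)]

/-- Pathwise bound of the gradient error when `Qt` approximates the exact value functions up to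
baselines `δ` and vanishing errors. -/
theorem limsup_ghat_le (hB : 0 < B) {k : Fin (K + 1)} {ω : Ω} {C : ℝ} (hC0 : 0 ≤ C)
    (hC : ∀ θ y, ‖π.scoreAt Θ θ y‖ ≤ C)
    {r : ℕ → EuclideanSpace ℝ (Fin nθ)} (hr : Tendsto r atTop (𝓝 0))
    (hgrad : ∃ l, Tendsto (fun n => ∑ i ∈ Finset.range n,
        η i • ((B : ℝ)⁻¹ • ∑ j ∈ Finset.range B,
          π.Q k (R.par hM hs i ω) (R.x (i * B + j) ω) (R.a (i * B + j) ω) •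
            π.scoreAt Θ (R.par hM hs i ω) (R.x (i * B + j) ω, R.a (i * B + j) ω)
          - π.gradF Θ k (R.par hM hs i ω) - r i)) atTop (𝓝 l))
    {δ : ℕ → ℝ} (hscore : ∃ l, Tendsto (fun N => ∑ i ∈ Finset.range N,
      (η i * δ i) • R.scoreMean hM hs i ω) atTop (𝓝 l))
    {Qt : ℕ → M.X → M.A → ℝ} {τ : ℕ → ℝ} (hτ : Tendsto τ atTop (𝓝 0))
    (hQt : ∀ i x a, ‖Qt i x a - π.Q k (R.par hM hs i ω) x a - δ i‖ ≤ τ i) :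
    limsup (fun i => ‖R.ghat i ω k - π.gradF Θ k (R.θ i ω)‖ₑ) atTop ≤
      ENNReal.ofReal C * limsup (fun i => ⨆ x, ⨆ a, ‖Qnet k (R.w i ω k) x a - Qt i x a‖ₑ) atTop := by
  obtain ⟨l, hl⟩ := hgrad
  obtain ⟨l', hl'⟩ := hscore
  obtain ⟨L, hL0, hL⟩ := hM.exists_lipschitz_gradF k
  obtain ⟨D, hD0, hD⟩ := R.exists_dist_par_le hM hs
  obtain ⟨bG, hbG⟩ := hM.gradient_bounded
  set S : ℕ → ℕ → EuclideanSpace ℝ (Fin nθ) := fun i j =>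
    π.scoreAt Θ (R.par hM hs i ω) (R.x (i * B + j) ω, R.a (i * B + j) ω) with hS
  set q : ℕ → ℕ → ℝ := fun i j => Qnet k (R.w i ω k) (R.x (i * B + j) ω) (R.a (i * B + j) ω) with hq
  set qt : ℕ → ℕ → ℝ := fun i j => Qt i (R.x (i * B + j) ω) (R.a (i * B + j) ω) with hqt
  set q0 : ℕ → ℕ → ℝ := fun i j =>
    π.Q k (R.par hM hs i ω) (R.x (i * B + j) ω) (R.a (i * B + j) ω) with hq0
  -- Here r1 carries the error of the network relative to Qt, and r2 the vanishing error of Qt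
  -- relative to Q plus the baseline δ.
  set r1 : ℕ → EuclideanSpace ℝ (Fin nθ) := fun i =>
    (B : ℝ)⁻¹ • ∑ j ∈ Finset.range B, (q i j - qt i j) • S i j with hr1
  set r2 : ℕ → EuclideanSpace ℝ (Fin nθ) := fun i =>
    (B : ℝ)⁻¹ • ∑ j ∈ Finset.range B, (qt i j - q0 i j - δ i) • S i j with hr2
  have hr20 : Tendsto r2 atTop (𝓝 0) := by
    refine squeeze_zero_norm (a := fun i => τ i * C) (fun i => norm_batch_le hB fun j => ?_) ?_
    · rw [norm_smul]
      exact mul_le_mul (hQt i _ _) (hC _ _) (norm_nonneg _) ((norm_nonneg _).trans (hQt i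
        (R.x 0 ω) (R.a 0 ω)))
    · simpa using hτ.mul_const C
  have hsplit : ∀ i, (B : ℝ)⁻¹ • ∑ j ∈ Finset.range B, q i j • S i j =
      r1 i + r2 i + (B : ℝ)⁻¹ • ∑ j ∈ Finset.range B, q0 i j • S i j
        + δ i • R.scoreMean hM hs i ω := by
    intro i
    have e : R.scoreMean hM hs i ω = (B : ℝ)⁻¹ • ∑ j ∈ Finset.range B, S i j := rfl
    rw [e, smul_comm, Finset.smul_sum (r := δ i), hr1, hr2]
    simp only
    rw [← smul_add, ← smul_add, ← smul_add, ← Finset.sum_add_distrib, ← Finset.sum_add_distrib,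
      ← Finset.sum_add_distrib]
    congr 1
    exact Finset.sum_congr rfl fun j _ => by module
  have key := hs.limsup_tracking (est := fun i => R.ghat i ω k)
    (m := fun i => π.gradF Θ k (R.par hM hs i ω)) (r := fun i => r1 i + (r2 i + r i)) (L := L * D)
    (β := fun i => (B : ℝ)⁻¹ • ∑ j ∈ Finset.range B, q i j • S i j)
    (fun i => hbG k _ (R.par hM hs i ω).2)
    (fun i => (hL _ _).trans (by
      rw [mul_assoc]; exact mul_le_mul_of_nonneg_left (hD i ω) hL0))
    (fun i => R.ghat_succ i ω k) ⟨l + l', by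
      refine (hl.add hl').congr fun n => ?_
      rw [← Finset.sum_add_distrib]
      refine Finset.sum_congr rfl fun i _ => ?_
      rw [hsplit i]
      module⟩
  refine key.trans ?_
  -- Only the network error survives in the limit.
  have hadd : limsup (fun i => ‖r1 i + (r2 i + r i)‖ₑ) atTop ≤
      limsup (fun i => ‖r1 i‖ₑ) atTop := by
    refine (limsup_le_limsup (Eventually.of_forall fun i => enorm_add_le _ _)).trans_eq ?_
    exact ENNReal.limsup_add_of_right_tendsto_zero
      (tendsto_enorm_zero (by simpa using hr20.add hr)) _
  refine hadd.trans ?_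
  rw [← ENNReal.limsup_const_mul_of_ne_top ENNReal.ofReal_ne_top]
  refine limsup_le_limsup (Eventually.of_forall fun i => ?_)
  simp only
  set s := ⨆ x, ⨆ a, ‖Qnet k (R.w i ω k) x a - Qt i x a‖ₑ with hsup
  -- An infinite supremum makes the bound trivial unless C = 0, where 0 * ⊤ = 0 in `ℝ≥0∞`; in that
  -- case the scores, and hence r1, vanish.
  by_cases hst : s = ⊤
  · rcases hC0.eq_or_lt with hC' | hC'
    · have : r1 i = 0 := by
        rw [hr1]
        simp only
        rw [Finset.sum_eq_zero, smul_zero]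
        intro j _
        have : ‖S i j‖ ≤ 0 := hC' ▸ hC _ _
        rw [norm_le_zero_iff.1 this, smul_zero]
      simp [this]
    · rw [hst, ENNReal.mul_top (by simpa using hC')]
      exact le_top
  · rw [← ofReal_norm, ← ENNReal.ofReal_toReal hst, ← ENNReal.ofReal_mul hC0]
    refine ENNReal.ofReal_le_ofReal (norm_batch_le hB fun j => ?_)
    rw [norm_smul, mul_comm]
    refine mul_le_mul (hC _ _) ?_ (norm_nonneg _) hC0
    rw [← toReal_enorm]
    exact ENNReal.toReal_mono hst (le_iSup₂ (f := fun x a =>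
      ‖Qnet k (R.w i ω k) x a - Qt i x a‖ₑ) (R.x (i * B + j) ω) (R.a (i * B + j) ω))

end Run

end CACRL

/-! ### Surrogate value functions -/

namespace CACRL

variable {nS nZ nA K nθ nω : ℕ} {M : CMDP nS nZ nA K} {π : Policy M nθ}
  {Θ : Set (EuclideanSpace ℝ (Fin nθ))} {B : ℕ} {η μ : ℕ → ℝ} {ζ : Fin (K + 1) → ℝ}
  {Qnet : Fin (K + 1) → EuclideanSpace ℝ (Fin nω) → M.X → M.A → ℝ}
  {Ω : Type*} [mΩ : MeasurableSpace Ω] {P : Measure Ω}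

/-- An error in the average-cost estimate shifts the surrogate by a constant in (x, a), that is, by
a baseline. -/
theorem Policy.Qhat_eq (π : Policy M nθ) (k : Fin (K + 1)) (θ : EuclideanSpace ℝ (Fin nθ))
    (c c' : ℝ) (T : ℕ) (x : M.X) (a : M.A) :
    π.Qhat k θ c T x a = π.Qhat k θ c' T x a + T * (c' - c) := by
  simp only [Policy.Qhat, Finset.sum_sub_distrib, Finset.sum_const, Finset.card_range,
    nsmul_eq_mul]
  ring

namespace Run

variable (R : Run M π Θ B η μ ζ Qnet P) (hM : ProblemAssumptions M π Θ)
  (hs : StepSizeAssumptions η μ) {d : Θ → Measure M.X} {c ρ b : ℝ}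
  (h : IsErgodicFamily (π.chainKernel Θ) d (fun θ t => π.nStep θ t) c ρ)
  (hb : ∀ k x a x', |M.shapedCost k x a x'| ≤ b) [IsProbabilityMeasure P] {C : ℝ}
include hM hs h hb

theorem ae_limsup_ghat_le_of_Q (hB : 0 < B) (k : Fin (K + 1)) (hC0 : 0 ≤ C)
    (hC : ∀ θ y, ‖π.scoreAt Θ θ y‖ ≤ C) :
    ∀ᵐ ω ∂P, limsup (fun i => ‖R.ghat i ω k - π.gradF Θ k (R.θ i ω)‖ₑ) atTop ≤
      ENNReal.ofReal C * limsup (fun i => ⨆ x, ⨆ a,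
        ‖Qnet k (R.w i ω k) x a - π.Q k (R.θ i ω) x a‖ₑ) atTop := by
  filter_upwards [R.ae_exists_tendsto_policyGradient hM hs h hb hB k] with ω ⟨r, hr, hgrad⟩
  refine R.limsup_ghat_le hM hs hB hC0 hC hr hgrad (δ := fun _ => 0) ⟨0, by simp⟩
    (Qt := fun i => π.Q k (R.θ i ω)) (τ := fun _ => 0) tendsto_const_nhds fun i x a => ?_
  change ‖π.Q k (R.θ i ω) x a - π.Q k (R.θ i ω) x a - 0‖ ≤ 0
  simp

/-- The baseline T_i (fdot - fhat_i) need not tend to 0, since T_i may grow arbitrarily fast. It is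
predictable, and it is bounded wherever the surrogates are, so its product with the scores is
harmless. -/
theorem ae_limsup_ghat_le_of_Qhat (hB : 0 < B) (k : Fin (K + 1)) (hC0 : 0 ≤ C)
    (hC : ∀ θ y, ‖π.scoreAt Θ θ y‖ ≤ C) {T : ℕ → ℕ} (hT : Tendsto T atTop atTop) :
    ∀ᵐ ω ∂P,
      (∃ b : ℝ, ∀ i x a, |π.Qhat k (R.θ i ω) (R.fhat i ω k) (T i) x a| ≤ b) →
      limsup (fun i => ‖R.ghat i ω k - π.gradF Θ k (R.θ i ω)‖ₑ) atTop ≤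
        ENNReal.ofReal C * limsup (fun i => ⨆ x, ⨆ a, ‖Qnet k (R.w i ω k) x a -
          π.Qhat k (R.θ i ω) (R.fhat i ω k) (T i) x a‖ₑ) atTop := by
  obtain ⟨τ, hτ, hQτ⟩ := hM.exists_truncation_bound h hb
  obtain ⟨-, bq, hbq0, hbq⟩ := hM.valueAt_prop h hb k
  obtain ⟨bτ, hbτ⟩ := hτ.bddAbove_range
  set δ : ℕ → Ω → ℝ := fun i ω => T i * (π.fdot k (R.θ i ω) - R.fhat i ω k) with hδ
  have hδm : ∀ i, Measurable[R.ℱ (i * B)] (δ i) := by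
    intro i
    have h1 : Measurable fun θ : Θ => π.fdot k θ := by
      have := (h.stronglyMeasurable_mean (hM.isBddMeas_meanAt hb k)).measurable
      simpa only [← hM.fdot_eq h hb] using this
    exact ((h1.comp (R.measurable_par hM hs i)).sub (R.measurable_fhat i k)).const_mul _
  -- The bound on the baseline depends on the outcome, whereas the martingale argument needs a
  -- deterministic one. The baseline is therefore cut off at every integer level; these are
  -- countably many null sets.
  have hscore : ∀ n : ℕ, ∀ᵐ ω ∂P, ∃ l, Tendsto (fun N => ∑ i ∈ Finset.range N,
      (η i * (if |δ i ω| ≤ n then δ i ω else 0)) • R.scoreMean hM hs i ω) atTop (𝓝 l) := by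
    intro n
    refine R.ae_exists_tendsto_score hM hs hB (δ := fun i ω => if |δ i ω| ≤ n then δ i ω else 0)
      (n := n) (fun i => ?_) fun i ω => ?_
    · exact Measurable.ite (measurableSet_le (measurable_norm.comp (hδm i)) measurable_const)
        (hδm i) measurable_const
    · split_ifs with h1
      · exact h1
      · simp
  filter_upwards [R.ae_exists_tendsto_policyGradient hM hs h hb hB k, ae_all_iff.2 hscore]
    with ω ⟨r, hr, hgrad⟩ hsc ⟨b', hb'⟩
  have hQhat : ∀ i x a, π.Qhat k (R.θ i ω) (R.fhat i ω k) (T i) x a =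
      π.Qhat k (R.par hM hs i ω) (π.fdot k (R.par hM hs i ω)) (T i) x a + δ i ω :=
    fun i x a => π.Qhat_eq k _ _ _ _ x a
  have hdist : ∀ i x a, ‖π.Qhat k (R.θ i ω) (R.fhat i ω k) (T i) x a -
      π.Q k (R.par hM hs i ω) x a - δ i ω‖ ≤ τ (T i) := by
    intro i x a
    rw [hQhat, sub_right_comm, add_sub_cancel_right, norm_sub_rev]
    exact hQτ k (R.par hM hs i ω) x a (T i)
  -- The baseline is surrogate minus Q minus truncation error, so at this level the cutoff is
  -- inactive along the whole path.
  obtain ⟨n, hn⟩ := exists_nat_ge (b' + bq + bτ)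
  have hδn : ∀ i, |δ i ω| ≤ n := by
    intro i
    have h1 := hdist i (R.x 0 ω) (R.a 0 ω)
    have h2 := hb' i (R.x 0 ω) (R.a 0 ω)
    have h3 := hbq.le (R.par hM hs i ω) (R.x 0 ω, R.a 0 ω)
    rw [← hM.Q_eq h hb] at h3
    have h4 : τ (T i) ≤ bτ := hbτ ⟨T i, rfl⟩
    rw [Real.norm_eq_abs, abs_le] at h1 h3
    rw [abs_le] at h2 ⊢
    constructor <;> linarith [h1.1, h1.2, h2.1, h2.2, h3.1, h3.2]
  refine R.limsup_ghat_le hM hs hB hC0 hC hr hgrad (δ := fun i => δ i ω) ?_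
    (Qt := fun i => π.Qhat k (R.θ i ω) (R.fhat i ω k) (T i)) (τ := fun i => τ (T i))
    (hτ.comp hT) hdist
  obtain ⟨l, hl⟩ := hsc n
  exact ⟨l, by simpa only [hδn, if_true] using hl⟩

end Run

end CACRL

/-! ### Asymptotic consistency of the surrogates -/

theorem lemma2 {nS nZ nA K nθ : ℕ} (M : CACRL.CMDP nS nZ nA K) (π : CACRL.Policy M nθ)
    (Θ : Set (EuclideanSpace ℝ (Fin nθ))) (hM : CACRL.ProblemAssumptions M π Θ) :
    -- the limits defining `ḟ_k` exist and the series defining `Q_k` converge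
    (∀ k, ∀ θ ∈ Θ, Tendsto (π.avgCost k θ) atTop (𝓝 (π.fdot k θ))) ∧
    (∀ k, ∀ θ ∈ Θ, ∀ x a, Summable (fun l => π.costAt k θ x a l - π.fdot k θ)) ∧
    ∃ C : ℝ, 0 < C ∧
      ∀ (nω B : ℕ) (η μ : ℕ → ℝ) (ζ : Fin (K + 1) → ℝ)
        (Qnet : Fin (K + 1) → EuclideanSpace ℝ (Fin nω) → M.X → M.A → ℝ),
        0 < B → CACRL.StepSizeAssumptions η μ → (∀ k, 0 < ζ k) →
      ∀ (Ω : Type*) [MeasurableSpace Ω] (P : Measure Ω) [IsProbabilityMeasure P]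
        (R : CACRL.Run M π Θ B η μ ζ Qnet P) (k : Fin (K + 1)),
        -- consistency of the function values
        (∀ᵐ ω ∂P, Tendsto (fun i => |R.fhat i ω k - π.fdot k (R.θ i ω)|) atTop (𝓝 0)) ∧
        -- consistency of the gradients up to the error of the Q-networks relative to the
        -- surrogate value functions with estimate `f̂_{k,i}`, along any horizons `T_i → ∞`
        (∀ T : ℕ → ℕ, Tendsto T atTop atTop →
          ∀ᵐ ω ∂P,
            (∃ b : ℝ, ∀ i x a, |π.Qhat k (R.θ i ω) (R.fhat i ω k) (T i) x a| ≤ b) →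
            limsup (fun i => ‖R.ghat i ω k - π.gradF Θ k (R.θ i ω)‖ₑ) atTop ≤
              ENNReal.ofReal C * limsup (fun i => ⨆ x, ⨆ a,
                ‖Qnet k (R.w i ω k) x a -
                  π.Qhat k (R.θ i ω) (R.fhat i ω k) (T i) x a‖ₑ) atTop) ∧
        -- the same relative to the exact value functions
        (∀ᵐ ω ∂P,
          limsup (fun i => ‖R.ghat i ω k - π.gradF Θ k (R.θ i ω)‖ₑ) atTop ≤
            ENNReal.ofReal C * limsup (fun i => ⨆ x, ⨆ a,
              ‖Qnet k (R.w i ω k) x a - π.Q k (R.θ i ω) x a‖ₑ) atTop) := by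
  obtain ⟨b, hb⟩ := hM.cost_bounded
  obtain ⟨d, c, ρ, h⟩ := hM.exists_isErgodicFamily
  -- The constant C is a uniform bound on the score, increased by 1 to be positive; it is fixed
  -- before any step size, batch size, network or run.
  obtain ⟨-, bs, hbs0, hbs⟩ := hM.scoreAt_prop
  refine ⟨fun k θ hθ => ?_, fun k θ hθ x a => hM.summable_costAt h hb k ⟨θ, hθ⟩ x a,
    bs + 1, by positivity, ?_⟩
  · have := hM.tendsto_avgCost h hb k ⟨θ, hθ⟩
    rwa [← hM.fdot_eq h hb] at this
  · intro nω B η μ ζ Qnet hB hs hζ Ω _ P _ R k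
    have hC : ∀ θ y, ‖π.scoreAt Θ θ y‖ ≤ bs + 1 := fun θ y => (hbs.le θ y).trans (by linarith)
    exact ⟨R.ae_tendsto_fhat hM hs h hb hB k,
      fun T hT => R.ae_limsup_ghat_le_of_Qhat hM hs h hb hB k (by positivity) hC hT,
      R.ae_limsup_ghat_le_of_Q hM hs h hb hB k (by positivity) hC⟩
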